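/- Let $A$ and $B$ be $C^*$-algebras, $\mathcal M(B)$ the multiplier algebra of $B$, and $\varphi\colon A\to\mathcal M(B)$ a $^*$-homomorphism. "Ideal" means closed two-sided ideal; ideals are ordered by inclusion, meets are intersections, and the join of a family is the smallest ideal containing all its members. Empty meets (the whole algebra) and empty joins (the zero ideal) are allowed. For an ideal $J$ of $B$ and an ideal $I$ of $A$ let $$r(J)=\{a\in A:\ \varphi(a)B+B\varphi(a)\subseteq J\},\qquad i(I)=\overline{\operatorname{span}}\,B\varphi(I)B .$$ Ideals of the form $r(J)$ are called restricted, ideals of the form $i(I)$ are called induced. Let $\operatorname{Prime}(B)$ be the space of prime ideals of $B$ and $\operatorname{Prime}^B(A)$ the space of prime elements of the complete lattice of restricted ideals of $A$ (a prime element is a $p\neq$ top with $I\wedge J\le p\Rightarrow I\le p$ or $J\le p$), each with the topology whose open sets are the sets $\{p: I\not\subseteq p\}$, where $I$ runs through the ideals of $B$, respectively the restricted ideals of $A$. Let $\check A$ and $\check B\subseteq\operatorname{Prime}(B)$ be the primitive ideal spaces with the hull-kernel topology. Consider the conditions * (JR) joins of restricted ideals are restricted; * (C1) $I\cap r(i(J))=r(i(I\cap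 J))$ for every restricted ideal $I$ and every ideal $J$ of $A$; * (MI)$_{\mathrm f}$ finite meets of induced ideals are induced; * (MI) arbitrary meets of induced ideals are induced; * (C2) $I\cap F(J)=F(I\cap J)$ for every induced ideal $I$ and every ideal $J$ of $B$, where $F(J)$ is the meet of all induced ideals containing $J$. Then: 1. If $r\colon\operatorname{Prime}(B)\to\operatorname{Prime}^B(A)$ is a well-defined, continuous, open and surjective map, then (MI) and (C2) hold, and $F(J)$ is the smallest induced ideal containing $J$, for every ideal $J$ of $B$. 2. Conversely, if (MI) and (C2) hold and $\operatorname{Prime}^B(A)$ is first countable, then $r\colon\check B\to\operatorname{Prime}^B(A)$ is a well-defined, continuous, open surjection. The space $\operatorname{Prime}^B(A)$ is first countable if $\check A$ is second countable. 3. Suppose that (JR), (C1) and (MI)$_{\mathrm f}$ hold and that $\operatorname{Prime}^B(A)$ is first countable. Let $\pi\colon\check A\to\operatorname{Prime}^B(A)$ map $\mathfrak p$ to the largest restricted ideal contained in $\mathfrak p$, and let $\check A/{\sim}$ be the quotient space of $\check A$ by the relation $\mathfrak p\sim\mathfrak q\iff\pi(\mathfrak p)=\pi(\mathfrak q)$.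 Then $\pi$ induces a homeomorphism $\pi_*\colon\check A/{\sim}\to\operatorname{Prime}^B(A)$, the map $r\colon\check B\to\operatorname{Prime}^B(A)$ is well defined, and the quasi-orbit map $\varrho=\pi_*^{-1}\circ r\colon\check B\to\check A/{\sim}$ is continuous. The map $\varrho$ is open and surjective if and only if (MI) and (C2) hold. -/

import Mathlib

open scoped MultiplierAlgebra

universe u v

/-! ### The complete lattice of closed two-sided ideals -/

/-- An ideal of a C⋆-algebra: a norm-closed two-sided ideal (a closed linear subspace that is
stable under left and right multiplication by the algebra). -/
structure ClosedIdeal (A : Type u) [NonUnitalCStarAlgebra A] extends Submodule ℂ A where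
  mul_left_mem : ∀ (a : A) {x : A}, x ∈ carrier → a * x ∈ carrier
  mul_right_mem : ∀ (a : A) {x : A}, x ∈ carrier → x * a ∈ carrier
  closed : IsClosed carrier

namespace ClosedIdeal

variable {A : Type u} [NonUnitalCStarAlgebra A]

instance : SetLike (ClosedIdeal A) A where
  coe I := I.carrier
  coe_injective I J h := by
    cases I; cases J; congr; exact SetLike.coe_injective h

/-- Ideals are ordered by inclusion. -/
instance : PartialOrder (ClosedIdeal A) := PartialOrder.ofSetLike (ClosedIdeal A) A

@[ext]
theorem ext {I J : ClosedIdeal A} (h : ∀ x, x ∈ I ↔ x ∈ J) : I = J := SetLike.ext h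

theorem le_iff {I J : ClosedIdeal A} : I ≤ J ↔ ∀ x, x ∈ I → x ∈ J := Iff.rfl

/-- The meet of a family of ideals is the intersection (all of `A` for the empty family). -/
instance : InfSet (ClosedIdeal A) where
  sInf S :=
    { carrier := {x | ∀ I ∈ S, x ∈ I}
      zero_mem' := fun I _ => I.zero_mem'
      add_mem' := fun hx hy I hI => I.add_mem' (hx I hI) (hy I hI)
      smul_mem' := fun c _ hx I hI => I.smul_mem' c (hx I hI)
      mul_left_mem := fun a _ hx I hI => I.mul_left_mem a (hx I hI)
      mul_right_mem := fun a _ hx I hI => I.mul_right_mem a (hx I hI)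
      closed := by
        have h : {x | ∀ I ∈ S, x ∈ I} = ⋂ I ∈ S, (I : Set A) := by ext; simp
        rw [h]
        exact isClosed_biInter fun I _ => I.closed }

theorem mem_sInf {S : Set (ClosedIdeal A)} {x : A} : x ∈ sInf S ↔ ∀ I ∈ S, x ∈ I := Iff.rfl

/-- The complete lattice of ideals: meets are intersections, and the join of a family is the
smallest ideal containing all its members. -/
instance : CompleteLattice (ClosedIdeal A) where
  __ := completeLatticeOfInf (ClosedIdeal A) fun _ =>
    ⟨fun I hI _ hx => hx I hI, fun _ hK _ hx _ hI => hK hI hx⟩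
  inf I J :=
    { carrier := {x | x ∈ I ∧ x ∈ J}
      zero_mem' := ⟨I.zero_mem', J.zero_mem'⟩
      add_mem' := fun hx hy => ⟨I.add_mem' hx.1 hy.1, J.add_mem' hx.2 hy.2⟩
      smul_mem' := fun c _ hx => ⟨I.smul_mem' c hx.1, J.smul_mem' c hx.2⟩
      mul_left_mem := fun a _ hx => ⟨I.mul_left_mem a hx.1, J.mul_left_mem a hx.2⟩
      mul_right_mem := fun a _ hx => ⟨I.mul_right_mem a hx.1, J.mul_right_mem a hx.2⟩
      closed := I.closed.inter J.closed }
  inf_le_left _ _ _ hx := hx.1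
  inf_le_right _ _ _ hx := hx.2
  le_inf _ _ _ h₁ h₂ _ hx := ⟨h₁ hx, h₂ hx⟩

theorem mem_inf {I J : ClosedIdeal A} {x : A} : x ∈ I ⊓ J ↔ x ∈ I ∧ x ∈ J := Iff.rfl

theorem mem_top {x : A} : x ∈ (⊤ : ClosedIdeal A) := by
  rw [← sInf_empty, mem_sInf]; simp

end ClosedIdeal

/-! ### Spaces of prime elements -/

/-- The space of (meet-)prime elements of a complete lattice `L`: elements `p ≠ ⊤` such that
`I ⊓ J ≤ p` implies `I ≤ p` or `J ≤ p`. -/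
def PrimeSpace (L : Type u) [CompleteLattice L] : Type u := {p : L // InfPrime p}

/-- The hull-kernel topology: the open sets are `U_I = {p | ¬ I ≤ p}` for `I` in `L`. -/
instance PrimeSpace.instTopologicalSpace (L : Type u) [CompleteLattice L] :
    TopologicalSpace (PrimeSpace L) where
  IsOpen U := ∃ I : L, U = {p | ¬ I ≤ p.1}
  isOpen_univ := ⟨⊤, by
    ext p
    simpa [top_le_iff, isMax_iff_eq_top] using p.2.1⟩
  isOpen_inter := by
    rintro _ _ ⟨I, rfl⟩ ⟨J, rfl⟩
    refine ⟨I ⊓ J, ?_⟩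
    ext p
    simp only [Set.mem_inter_iff, Set.mem_ofPred_eq, ← not_or]
    exact not_congr ⟨fun h => h.elim inf_le_of_left_le inf_le_of_right_le, fun h => p.2.2 h⟩
  isOpen_sUnion := by
    intro S hS
    refine ⟨sSup {I | {p : PrimeSpace L | ¬ I ≤ p.1} ∈ S}, ?_⟩
    ext p
    simp only [Set.mem_sUnion, Set.mem_ofPred_eq, sSup_le_iff, not_forall]
    constructor
    · rintro ⟨U, hU, hp⟩
      obtain ⟨I, rfl⟩ := hS U hU
      exact ⟨I, hU, hp⟩
    · rintro ⟨I, hI, hp⟩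
      exact ⟨_, hI, hp⟩

/-! ### Primitive ideals -/

section Primitive

variable {A : Type u} [NonUnitalCStarAlgebra A]

/-- A `⋆`-representation on a Hilbert space is irreducible if it is nonzero and the only closed
invariant subspaces are the trivial ones. -/
def IsIrreducibleRep {H : Type u} [NormedAddCommGroup H] [InnerProductSpace ℂ H] [CompleteSpace H]
    (ρ : A →⋆ₙₐ[ℂ] (H →L[ℂ] H)) : Prop :=
  (∃ a, ρ a ≠ 0) ∧
    ∀ K : Submodule ℂ H, IsClosed (K : Set H) → (∀ a, ∀ x ∈ K, ρ a x ∈ K) → K = ⊥ ∨ K = ⊤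

/-- A primitive ideal is the kernel of an irreducible representation on a Hilbert space.  An
irreducible representation is cyclic, so its space is a completion of a quotient of `A`; hence it
is no restriction to take the Hilbert space in the universe of `A`. -/
def ClosedIdeal.IsPrimitive (p : ClosedIdeal A) : Prop :=
  ∃ (H : Type u) (_ : NormedAddCommGroup H) (_ : InnerProductSpace ℂ H) (_ : CompleteSpace H)
    (ρ : A →⋆ₙₐ[ℂ] (H →L[ℂ] H)), IsIrreducibleRep ρ ∧ ∀ a, a ∈ p ↔ ρ a = 0

/-- Primitive ideals are prime. -/
theorem ClosedIdeal.IsPrimitive.infPrime {p : ClosedIdeal A} (hp : p.IsPrimitive) :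
    InfPrime p := by
  obtain ⟨H, _, _, _, ρ, ⟨⟨a₀, ha₀⟩, hirr⟩, hker⟩ := hp
  refine ⟨fun hmax => ha₀ ((hker a₀).1 ?_), fun I J hIJ => ?_⟩
  · rw [isMax_iff_eq_top] at hmax
    rw [hmax]; exact ClosedIdeal.mem_top
  · by_contra! hcon
    obtain ⟨hI, hJ⟩ := hcon
    let S : Submodule ℂ H := Submodule.span ℂ {x | ∃ a ∈ J, ∃ y, x = ρ a y}
    let K := S.topologicalClosure
    have hinv : ∀ a, ∀ x ∈ K, ρ a x ∈ K := by
      intro a x hx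
      have hS : ∀ y ∈ S, ρ a y ∈ S := by
        intro y hy
        refine Submodule.span_induction ?_ ?_ ?_ ?_ hy
        · rintro _ ⟨b, hb, z, rfl⟩
          refine Submodule.subset_span ⟨a * b, J.mul_left_mem a hb, z, ?_⟩
          simp [map_mul]
        · simp
        · intro x y _ _ hx hy
          rw [map_add]; exact add_mem hx hy
        · intro c x _ hx
          rw [map_smul]; exact S.smul_mem c hx
      exact map_mem_closure (ρ a).continuous hx hS
    rcases hirr K S.isClosed_topologicalClosure hinv with h | h
    · refine hJ fun b hb => (hker b).2 ?_
      ext y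
      have : ρ b y ∈ K := S.le_topologicalClosure (Submodule.subset_span ⟨b, hb, y, rfl⟩)
      rw [h] at this
      simpa using this
    · refine hI fun a ha => (hker a).2 ?_
      have hK : K ≤ LinearMap.ker (ρ a : H →ₗ[ℂ] H) := by
        refine Submodule.topologicalClosure_minimal _ ?_ (ρ a).isClosed_ker
        rw [Submodule.span_le]
        rintro _ ⟨b, hb, z, rfl⟩
        have h0 : ρ (a * b) = 0 :=
          (hker _).1 (hIJ ⟨I.mul_right_mem b ha, J.mul_left_mem a hb⟩)
        have h1 := congrArg (fun T : H →L[ℂ] H => T z) h0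
        simpa [map_mul] using h1
      ext y
      have : y ∈ K := by rw [h]; trivial
      simpa using hK this

variable (A) in
/-- The set of primitive ideals of `A`. -/
def PrimitiveSpace : Type u := {p : ClosedIdeal A // p.IsPrimitive}

/-- Primitive ideals as points of the prime ideal space. -/
def PrimitiveSpace.toPrime (p : PrimitiveSpace A) : PrimeSpace (ClosedIdeal A) :=
  ⟨p.1, p.2.infPrime⟩

/-- The hull-kernel topology on the primitive ideal space, that is, the subspace topology from the
prime ideal space. -/
instance PrimitiveSpace.instTopologicalSpace : TopologicalSpace (PrimitiveSpace A) :=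
  TopologicalSpace.induced PrimitiveSpace.toPrime inferInstance

end Primitive

/-! ### Restriction and induction of ideals -/

section Restriction

variable {A : Type u} {B : Type v} [NonUnitalCStarAlgebra A] [NonUnitalCStarAlgebra B]

/-- A closed ideal is determined on products with arbitrary elements: if `b * y ∈ J` for all `b`,
then `y ∈ J`. -/
theorem ClosedIdeal.mem_of_forall_mul_mem (J : ClosedIdeal B) {y : B}
    (h : ∀ b : B, b * y ∈ J) : y ∈ J := by
  let _ := CStarAlgebra.spectralOrder B
  let _ := CStarAlgebra.spectralOrderedRing B
  have ht := (CStarAlgebra.increasingApproximateUnit B).tendsto_mul_right y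
  exact J.closed.mem_of_tendsto ht (Filter.Eventually.of_forall h)

theorem ClosedIdeal.mem_of_forall_mem_mul (J : ClosedIdeal B) {y : B}
    (h : ∀ b : B, y * b ∈ J) : y ∈ J := by
  let _ := CStarAlgebra.spectralOrder B
  let _ := CStarAlgebra.spectralOrderedRing B
  have ht := (CStarAlgebra.increasingApproximateUnit B).tendsto_mul_left y
  exact J.closed.mem_of_tendsto ht (Filter.Eventually.of_forall h)

/-- Restriction of an ideal `J` of `B` along `φ : A → 𝓜(ℂ, B)`: the set of all `a` with
`φ(a) · B + B · φ(a) ⊆ J`.  For a multiplier `m`, `m.fst b` is `m · b` and `m.snd b` is `b · m`. -/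
noncomputable def restrictIdeal (φ : A →⋆ₙₐ[ℂ] 𝓜(ℂ, B)) (J : ClosedIdeal B) : ClosedIdeal A where
  carrier := {a | ∀ b : B, (φ a).fst b ∈ J ∧ (φ a).snd b ∈ J}
  zero_mem' b := by
    rw [map_zero]
    exact ⟨J.zero_mem', J.zero_mem'⟩
  add_mem' hx hy b := by
    simpa using! And.intro (J.add_mem' (hx b).1 (hy b).1) (J.add_mem' (hx b).2 (hy b).2)
  smul_mem' c x hx b := by
    simpa using! And.intro (J.smul_mem' c (hx b).1) (J.smul_mem' c (hx b).2)
  mul_left_mem a x hx b := by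
    refine ⟨?_, ?_⟩
    · rw [map_mul, DoubleCentralizer.mul_fst]
      refine J.mem_of_forall_mul_mem fun c => ?_
      change c * (φ a).fst ((φ x).fst b) ∈ J
      rw [← (φ a).central]
      exact J.mul_left_mem _ (hx b).1
    · rw [map_mul, DoubleCentralizer.mul_snd]
      exact (hx _).2
  mul_right_mem a x hx b := by
    refine ⟨?_, ?_⟩
    · rw [map_mul, DoubleCentralizer.mul_fst]
      exact (hx _).1
    · rw [map_mul, DoubleCentralizer.mul_snd]
      refine J.mem_of_forall_mem_mul fun c => ?_
      change (φ a).snd ((φ x).snd b) * c ∈ J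
      rw [(φ a).central]
      exact J.mul_right_mem _ (hx b).2
  closed := by
    have h1 : ∀ b : B, Continuous fun a => (φ a).fst b := fun b => by
      refine AddMonoidHomClass.continuous_of_bound
        (AddMonoidHom.mk' (fun a => (φ a).fst b) (by simp)) ‖b‖ fun a => ?_
      calc ‖(φ a).fst b‖ ≤ ‖(φ a).fst‖ * ‖b‖ := ContinuousLinearMap.le_opNorm _ _
        _ = ‖φ a‖ * ‖b‖ := by rw [DoubleCentralizer.norm_fst]
        _ ≤ ‖a‖ * ‖b‖ := by gcongr; exact NonUnitalStarAlgHom.norm_apply_le φ a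
        _ = ‖b‖ * ‖a‖ := mul_comm _ _
    have h2 : ∀ b : B, Continuous fun a => (φ a).snd b := fun b => by
      refine AddMonoidHomClass.continuous_of_bound
        (AddMonoidHom.mk' (fun a => (φ a).snd b) (by simp)) ‖b‖ fun a => ?_
      calc ‖(φ a).snd b‖ ≤ ‖(φ a).snd‖ * ‖b‖ := ContinuousLinearMap.le_opNorm _ _
        _ = ‖φ a‖ * ‖b‖ := by rw [DoubleCentralizer.norm_snd]
        _ ≤ ‖a‖ * ‖b‖ := by gcongr; exact NonUnitalStarAlgHom.norm_apply_le φ a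
        _ = ‖b‖ * ‖a‖ := mul_comm _ _
    have h : {a | ∀ b : B, (φ a).fst b ∈ J ∧ (φ a).snd b ∈ J} =
        ⋂ b : B, ((fun a => (φ a).fst b) ⁻¹' J ∩ (fun a => (φ a).snd b) ⁻¹' J) := by
      ext; simp
    rw [h]
    exact isClosed_iInter fun b => (J.closed.preimage (h1 b)).inter (J.closed.preimage (h2 b))

theorem mem_restrictIdeal {φ : A →⋆ₙₐ[ℂ] 𝓜(ℂ, B)} {J : ClosedIdeal B} {a : A} :
    a ∈ restrictIdeal φ J ↔ ∀ b : B, (φ a).fst b ∈ J ∧ (φ a).snd b ∈ J := Iff.rfl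

/-- The linear span of the elements `b₁ φ(x) b₂` with `b₁, b₂ ∈ B` and `x ∈ I`. -/
noncomputable def inducedSpan (φ : A →⋆ₙₐ[ℂ] 𝓜(ℂ, B)) (I : ClosedIdeal A) : Submodule ℂ B :=
  Submodule.span ℂ {y | ∃ x ∈ I, ∃ b₁ b₂ : B, y = b₁ * (φ x).fst b₂}

theorem mul_mem_inducedSpan (φ : A →⋆ₙₐ[ℂ] 𝓜(ℂ, B)) (I : ClosedIdeal A) (b : B) {y : B}
    (hy : y ∈ inducedSpan φ I) : b * y ∈ inducedSpan φ I ∧ y * b ∈ inducedSpan φ I := by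
  refine Submodule.span_induction ?_ ?_ ?_ ?_ hy
  · rintro _ ⟨x, hx, b₁, b₂, rfl⟩
    refine ⟨Submodule.subset_span ⟨x, hx, b * b₁, b₂, (mul_assoc _ _ _).symm⟩,
      Submodule.subset_span ⟨x, hx, b₁, b₂ * b, ?_⟩⟩
    rw [← (φ x).central, ← (φ x).central, mul_assoc]
  · simp
  · intro x y _ _ hx hy
    rw [mul_add, add_mul]
    exact ⟨add_mem hx.1 hy.1, add_mem hx.2 hy.2⟩
  · intro c x _ hx
    rw [mul_smul_comm, smul_mul_assoc]
    exact ⟨Submodule.smul_mem _ c hx.1, Submodule.smul_mem _ c hx.2⟩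

/-- The ideal of `B` induced by an ideal `I` of `A`: the closed linear span of `B φ(I) B`. -/
noncomputable def induceIdeal (φ : A →⋆ₙₐ[ℂ] 𝓜(ℂ, B)) (I : ClosedIdeal A) : ClosedIdeal B where
  toSubmodule := (inducedSpan φ I).topologicalClosure
  mul_left_mem b _ hy := map_mem_closure (continuous_const_mul b) hy
    fun _ hz => (mul_mem_inducedSpan φ I b hz).1
  mul_right_mem b _ hy := map_mem_closure (f := fun y => y * b) (continuous_mul_const b) hy
    fun _ hz => (mul_mem_inducedSpan φ I b hz).2
  closed := (inducedSpan φ I).isClosed_topologicalClosure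

/-- An ideal of `A` is restricted if it is the restriction of some ideal of `B`. -/
def IsRestricted (φ : A →⋆ₙₐ[ℂ] 𝓜(ℂ, B)) (I : ClosedIdeal A) : Prop :=
  ∃ J : ClosedIdeal B, I = restrictIdeal φ J

/-- An ideal of `B` is induced if it is induced by some ideal of `A`. -/
def IsInduced (φ : A →⋆ₙₐ[ℂ] 𝓜(ℂ, B)) (J : ClosedIdeal B) : Prop :=
  ∃ I : ClosedIdeal A, J = induceIdeal φ I

/-- Meets of restricted ideals are restricted. -/
theorem IsRestricted.sInf {φ : A →⋆ₙₐ[ℂ] 𝓜(ℂ, B)} {S : Set (ClosedIdeal A)}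
    (hS : ∀ I ∈ S, IsRestricted φ I) : IsRestricted φ (sInf S) := by
  refine ⟨InfSet.sInf {J | restrictIdeal φ J ∈ S}, ?_⟩
  ext a
  rw [ClosedIdeal.mem_sInf, mem_restrictIdeal]
  constructor
  · exact fun h b => ⟨fun J hJ => (h _ hJ b).1, fun J hJ => (h _ hJ b).2⟩
  · intro h I hI
    obtain ⟨J, rfl⟩ := hS I hI
    exact fun b => ⟨(h b).1 J hI, (h b).2 J hI⟩

/-- The partially ordered set of restricted ideals of `A`. -/
def RestrictedIdeal (φ : A →⋆ₙₐ[ℂ] 𝓜(ℂ, B)) : Type u := {I : ClosedIdeal A // IsRestricted φ I}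

instance (φ : A →⋆ₙₐ[ℂ] 𝓜(ℂ, B)) : PartialOrder (RestrictedIdeal φ) :=
  inferInstanceAs (PartialOrder {I : ClosedIdeal A // IsRestricted φ I})

noncomputable instance (φ : A →⋆ₙₐ[ℂ] 𝓜(ℂ, B)) : InfSet (RestrictedIdeal φ) where
  sInf S := ⟨sInf (Subtype.val '' S), IsRestricted.sInf (by rintro _ ⟨I, _, rfl⟩; exact I.2)⟩

/-- The complete lattice of restricted ideals.  Its meets are the meets of ideals of `A`; its joins
are the least restricted upper bounds. -/
noncomputable instance (φ : A →⋆ₙₐ[ℂ] 𝓜(ℂ, B)) : CompleteLattice (RestrictedIdeal φ) where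
  __ := completeLatticeOfInf (RestrictedIdeal φ) fun S =>
    ⟨fun I hI => sInf_le (α := ClosedIdeal A) ⟨I, hI, rfl⟩,
      fun K hK => le_sInf (α := ClosedIdeal A) (by rintro _ ⟨I, hI, rfl⟩; exact hK hI)⟩
  inf I J := ⟨I.1 ⊓ J.1, by
    rw [← sInf_pair]
    refine IsRestricted.sInf ?_
    rintro K (rfl | rfl)
    exacts [I.2, J.2]⟩
  inf_le_left I J := inf_le_left (α := ClosedIdeal A)
  inf_le_right I J := inf_le_right (α := ClosedIdeal A)
  le_inf I J K h₁ h₂ := le_inf (α := ClosedIdeal A) h₁ h₂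

/-- Restriction of ideals, with values in the lattice of restricted ideals. -/
noncomputable def restrictTo (φ : A →⋆ₙₐ[ℂ] 𝓜(ℂ, B)) (J : ClosedIdeal B) : RestrictedIdeal φ :=
  ⟨restrictIdeal φ J, J, rfl⟩

/-- The space `Prime^B(A)` of prime elements of the lattice of restricted ideals. -/
abbrev RestrictedPrimeSpace (φ : A →⋆ₙₐ[ℂ] 𝓜(ℂ, B)) : Type u := PrimeSpace (RestrictedIdeal φ)

/-! ### The conditions on restricted and induced ideals -/

/-- (JR): arbitrary joins (the empty one included) of restricted ideals are restricted. -/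
def CondJR (φ : A →⋆ₙₐ[ℂ] 𝓜(ℂ, B)) : Prop :=
  ∀ S : Set (ClosedIdeal A), (∀ I ∈ S, IsRestricted φ I) → IsRestricted φ (sSup S)

/-- (C1): `I ∩ r(i(J)) = r(i(I ∩ J))` for every restricted ideal `I` and every ideal `J` of `A`. -/
def CondC1 (φ : A →⋆ₙₐ[ℂ] 𝓜(ℂ, B)) : Prop :=
  ∀ I J : ClosedIdeal A, IsRestricted φ I →
    I ⊓ restrictIdeal φ (induceIdeal φ J) = restrictIdeal φ (induceIdeal φ (I ⊓ J))

/-- (MI): arbitrary meets (the empty one, which is `B`, included) of induced ideals are induced. -/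
def CondMI (φ : A →⋆ₙₐ[ℂ] 𝓜(ℂ, B)) : Prop :=
  ∀ S : Set (ClosedIdeal B), (∀ J ∈ S, IsInduced φ J) → IsInduced φ (sInf S)

/-- (MI)_f: finite meets (the empty one, which is `B`, included) of induced ideals are induced. -/
def CondMIf (φ : A →⋆ₙₐ[ℂ] 𝓜(ℂ, B)) : Prop :=
  ∀ S : Set (ClosedIdeal B), S.Finite → (∀ J ∈ S, IsInduced φ J) → IsInduced φ (sInf S)

/-- `F(J)`: the meet of all induced ideals that contain `J`.  Under (MI) it is the smallest induced
ideal that contains `J`. -/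
def inducedHull (φ : A →⋆ₙₐ[ℂ] 𝓜(ℂ, B)) (J : ClosedIdeal B) : ClosedIdeal B :=
  sInf {K | IsInduced φ K ∧ J ≤ K}

/-- (C2): `I ∩ F(J) = F(I ∩ J)` for every induced ideal `I` and every ideal `J` of `B`. -/
def CondC2 (φ : A →⋆ₙₐ[ℂ] 𝓜(ℂ, B)) : Prop :=
  ∀ I J : ClosedIdeal B, IsInduced φ I → I ⊓ inducedHull φ J = inducedHull φ (I ⊓ J)

/-! ### The restriction maps on prime and primitive ideals -/

/-- The map `r : Prime(B) → Prime^B(A)` is well defined. -/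
def RestrictsPrimes (φ : A →⋆ₙₐ[ℂ] 𝓜(ℂ, B)) : Prop :=
  ∀ P : PrimeSpace (ClosedIdeal B), InfPrime (restrictTo φ P.1)

/-- The map `r : Prim(B) → Prime^B(A)` is well defined. -/
def RestrictsPrimitives (φ : A →⋆ₙₐ[ℂ] 𝓜(ℂ, B)) : Prop :=
  ∀ P : PrimitiveSpace B, InfPrime (restrictTo φ P.1)

/-- The map `r : Prime(B) → Prime^B(A)`, when it is well defined. -/
noncomputable def primeRestriction (φ : A →⋆ₙₐ[ℂ] 𝓜(ℂ, B)) (h : RestrictsPrimes φ) :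
    PrimeSpace (ClosedIdeal B) → RestrictedPrimeSpace φ :=
  fun P => ⟨restrictTo φ P.1, h P⟩

/-- The map `r : Prim(B) → Prime^B(A)`, when it is well defined. -/
noncomputable def primitiveRestriction (φ : A →⋆ₙₐ[ℂ] 𝓜(ℂ, B)) (h : RestrictsPrimitives φ) :
    PrimitiveSpace B → RestrictedPrimeSpace φ :=
  fun P => ⟨restrictTo φ P.1, h P⟩

/-! ### The quasi-orbit space and the quasi-orbit map -/

/-- Under (JR), the join of all restricted ideals contained in `P`; it is the largest restricted
ideal contained in `P`. -/
noncomputable def largestRestricted (φ : A →⋆ₙₐ[ℂ] 𝓜(ℂ, B)) (hJR : CondJR φ) (P : ClosedIdeal A) :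
    RestrictedIdeal φ :=
  ⟨sSup {I | IsRestricted φ I ∧ I ≤ P}, hJR _ fun _ hI => hI.1⟩

theorem le_largestRestricted_iff {φ : A →⋆ₙₐ[ℂ] 𝓜(ℂ, B)} (hJR : CondJR φ) (P : ClosedIdeal A)
    (I : RestrictedIdeal φ) : I ≤ largestRestricted φ hJR P ↔ I.1 ≤ P :=
  ⟨fun h => (show I.1 ≤ _ from h).trans (sSup_le fun _ hK => hK.2), fun h =>
    show I.1 ≤ sSup _ from le_sSup ⟨I.2, h⟩⟩

/-- The map `π : Prim(A) → Prime^B(A)` that sends a primitive ideal to the largest restricted ideal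
contained in it. -/
noncomputable def quasiOrbitProj (φ : A →⋆ₙₐ[ℂ] 𝓜(ℂ, B)) (hJR : CondJR φ) :
    PrimitiveSpace A → RestrictedPrimeSpace φ :=
  fun P => ⟨largestRestricted φ hJR P.1, by
    have hP := P.2.infPrime
    refine ⟨fun hmax => hP.1 ?_, fun I J hIJ => ?_⟩
    · have hA : IsRestricted φ (⊤ : ClosedIdeal A) := by
        rw [← sInf_empty]; exact IsRestricted.sInf (by simp)
      rw [isMax_iff_eq_top] at hmax ⊢
      let T : RestrictedIdeal φ := ⟨⊤, hA⟩
      have h : T ≤ largestRestricted φ hJR P.1 := by rw [hmax]; exact le_top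
      exact top_le_iff.1 ((le_largestRestricted_iff hJR P.1 T).1 h)
    · rw [le_largestRestricted_iff] at hIJ ⊢
      rw [le_largestRestricted_iff]
      exact hP.2 hIJ⟩

/-- The quasi-orbit space `Prim(A)/∼`, where `P ∼ Q` if and only if `π(P) = π(Q)`, with the
quotient topology. -/
abbrev QuasiOrbitSpace (φ : A →⋆ₙₐ[ℂ] 𝓜(ℂ, B)) (hJR : CondJR φ) : Type u :=
  Quotient (Setoid.ker (quasiOrbitProj φ hJR))

/-- The injective map `Prim(A)/∼ → Prime^B(A)` induced by `π`. -/
noncomputable def quasiOrbitEmbedding (φ : A →⋆ₙₐ[ℂ] 𝓜(ℂ, B)) (hJR : CondJR φ) :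
    QuasiOrbitSpace φ hJR → RestrictedPrimeSpace φ :=
  Quotient.lift (quasiOrbitProj φ hJR) fun _ _ h => h

/-- The quasi-orbit map `Prim(B) → Prim(A)/∼`: the composite of `r : Prim(B) → Prime^B(A)` with the
inverse of `Prim(A)/∼ → Prime^B(A)`, when `r` is well defined on `Prim(B)` and the latter map is
a homeomorphism. -/
noncomputable def quasiOrbitMap (φ : A →⋆ₙₐ[ℂ] 𝓜(ℂ, B)) (hJR : CondJR φ)
    (hr : RestrictsPrimitives φ) (he : IsHomeomorph (quasiOrbitEmbedding φ hJR)) :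
    PrimitiveSpace B → QuasiOrbitSpace φ hJR :=
  fun P => (he.homeomorph (quasiOrbitEmbedding φ hJR)).symm (primitiveRestriction φ hr P)

end Restriction

/-! ### Irreducible representations that annihilate a vector along a left ideal -/

section Unital

open scoped ComplexOrder InnerProductSpace

variable {A : Type u} [CStarAlgebra A]

/-! Induction `i` is left adjoint to restriction `r`, so `r i r = r` and `i r i = i`: restricted and
induced ideals correspond bijectively. The hard point is to produce primitive ideals over a given
prime `p` of the restricted lattice.

First countability supplies restricted ideals `I n`, none below `p`, such that any prime `q ≥ p`
above no `I n` equals `p`. Thus `r(P) = p` becomes countably many conditions on a primitive `P`: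
`i(p) ≤ P` and `i(I n) ≰ P`. Such a `P` exists by a Baire property of the primitive ideal space
(`exists_isPrimitive_of_dense`), once each `i(I n)` is dense relative to the hull of `i(p)`. That
density is exactly what (MI), (C2) and primeness of `p` give. Prescribing one further ideal `J ≰ P`
yields openness as well as surjectivity. For `A`, the closure operator `r ∘ i` and (C1) replace `F`
and (C2).

The Baire property needs no separability. A sequence `b n ∈ L n \ K` with `b n * b (n + 1) = b (n +
1)` takes the place of nested compact sets, and an irreducible representation with a vector killed
by `K` and fixed by all `b n` gives the point of intersection.

Conversely, if `r` is open, the image of the open set of `J` is the open set of some restricted `G`.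
As primitive ideals separate ideals, `i(G)` is the least induced ideal above `J`, and (MI) and (C2)
can be checked fibrewise (`condMI_and_condC2_of_open`). -/

theorem exists_contractive_functional_of_one_notMem (N : Ideal A) (hN : (1 : A) ∉ N) :
    ∃ f : A →ₗ[ℂ] ℂ, f 1 = 1 ∧ (∀ a, ‖f a‖ ≤ ‖a‖) ∧ ∀ n ∈ N, f n = 0 := by
  -- Everything at distance less than 1 from `1` is a unit, so a proper left ideal misses this ball
  -- and Hahn-Banach separates the two.
  have hdisj : Disjoint (Metric.ball (1 : A) 1) (N : Set A) := by
    rw [Set.disjoint_left]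
    intro x hx hxN
    have hx' : ‖1 - x‖ < 1 := by rwa [Metric.mem_ball, dist_comm, dist_eq_norm] at hx
    have hu := isUnit_one_sub_of_norm_lt_one hx'
    rw [sub_sub_cancel] at hu
    exact hN ((Ideal.eq_top_iff_one N).1 (N.eq_top_of_isUnit_mem hxN hu))
  have hconv : Convex ℝ (N : Set A) := by
    intro x hx y hy a b _ _ _
    rw [← Complex.coe_smul, ← Complex.coe_smul]
    exact N.add_mem ((N.restrictScalars ℂ).smul_mem _ hx) ((N.restrictScalars ℂ).smul_mem _ hy)
  obtain ⟨f, c, hball, hNc⟩ := RCLike.geometric_hahn_banach_open (𝕜 := ℂ)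
    (convex_ball (1 : A) 1) Metric.isOpen_ball hconv hdisj
  have hc : c ≤ 0 := by simpa using hNc 0 N.zero_mem
  have hf : ∀ n ∈ N, f n = 0 := by
    intro n hn
    by_contra h0
    have h1 := hNc (((c - 1 : ℝ) / f n : ℂ) • n) ((N.restrictScalars ℂ).smul_mem _ hn)
    rw [map_smul, smul_eq_mul, div_mul_cancel₀ _ h0] at h1
    have : c ≤ c - 1 := by simpa using h1
    linarith
  -- This `s` bounds the norm of `f`. Since `f 1` has real part `-s` and modulus at most `s`, it
  -- equals `-s`, and dividing `f` by `-s` normalizes it.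
  set s : ℝ := -(f 1).re with hs
  have hlt : ∀ x : A, ‖x‖ < 1 → -(f x).re < s := by
    intro x hx
    have h1 := hball (1 - x) (by simpa [Metric.mem_ball, dist_eq_norm] using hx)
    simp only [map_sub, RCLike.re_to_complex] at h1
    linarith
  have hs0 : 0 < s := by simpa using hlt 0 (by simp)
  have hbound : ∀ x : A, ‖f x‖ ≤ s * ‖x‖ := by
    intro x
    by_contra! hlt'
    have hfx : f x ≠ 0 := by
      intro h
      rw [h, norm_zero] at hlt'
      exact absurd hlt' (not_lt.2 (by positivity))
    have hfx' : 0 < ‖f x‖ := norm_pos_iff.2 hfx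
    have h1 := hlt (((-s : ℝ) / f x : ℂ) • x) (by
      rw [norm_smul, norm_div, Complex.norm_real, norm_neg, Real.norm_of_nonneg hs0.le,
        div_mul_eq_mul_div, div_lt_one hfx']
      exact hlt')
    rw [map_smul, smul_eq_mul, div_mul_cancel₀ _ hfx] at h1
    simp at h1
  have hf1 : f 1 = ((-s : ℝ) : ℂ) := by
    have h1 : ‖f 1‖ ≤ s := by
      rcases subsingleton_or_nontrivial A with h | h
      · rw [Subsingleton.elim (1 : A) 0, map_zero, norm_zero]; exact hs0.le
      · simpa using hbound 1
    have h2 : Complex.normSq (f 1) ≤ s ^ 2 := by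
      rw [Complex.normSq_eq_norm_sq]; gcongr
    rw [Complex.normSq_apply] at h2
    have h3 : (f 1).re = -s := by rw [hs]; ring
    apply Complex.ext
    · simpa using h3
    · rw [h3] at h2
      simp only [Complex.ofReal_im]
      nlinarith
  have hsC : (s : ℂ) ≠ 0 := by exact_mod_cast hs0.ne'
  refine ⟨(-(s : ℂ)⁻¹) • (f : A →ₗ[ℂ] ℂ), ?_, ?_, ?_⟩
  · simp [hf1, hsC]
  · intro a
    simp only [LinearMap.smul_apply, ContinuousLinearMap.coe_coe, norm_smul, norm_neg, norm_inv,
      Complex.norm_real, Real.norm_of_nonneg hs0.le]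
    rw [inv_mul_le_iff₀ hs0]
    exact hbound a
  · intro n hn
    simp [hf n hn]

theorem nonneg_apply_of_contractive [PartialOrder A] [StarOrderedRing A] (f : A →ₗ[ℂ] ℂ)
    (h1 : f 1 = 1) (hf : ∀ a, ‖f a‖ ≤ ‖a‖) {a : A} (ha : 0 ≤ a) : 0 ≤ f a := by
  have hnt : Nontrivial A := ⟨1, 0, fun h => by simp [h] at h1⟩
  have hsa : IsSelfAdjoint a := .of_nonneg ha
  have him : (f a).im = 0 := by
    -- Contractivity is tested on `1 + i t a`. The right side has no term linear in `t`, which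
    -- forces the imaginary part of `f a` to vanish.
    have key : ∀ t : ℝ, (1 - t * (f a).im) ^ 2 ≤ 1 + t ^ 2 * ‖a‖ ^ 2 := by
      intro t
      have hn : ‖(1 : A) + (t * Complex.I : ℂ) • a‖ ^ 2 ≤ 1 + t ^ 2 * ‖a‖ ^ 2 := by
        rw [sq, ← CStarRing.norm_star_mul_self]
        have hexp : star ((1 : A) + (t * Complex.I : ℂ) • a) * (1 + (t * Complex.I : ℂ) • a) =
            1 + ((t ^ 2 : ℝ) : ℂ) • (a * a) := by
          rw [star_add, star_one, star_smul, hsa.star_eq]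
          simp only [RCLike.star_def, map_mul, Complex.conj_ofReal, Complex.conj_I, add_mul,
            mul_add, one_mul, mul_one, mul_neg, neg_smul]
          have : -((t : ℂ) * Complex.I * (t * Complex.I)) = ((t ^ 2 : ℝ) : ℂ) := by
            push_cast; linear_combination (-(t : ℂ) ^ 2) * Complex.I_sq
          rw [neg_mul, smul_mul_smul_comm, ← this, neg_smul]; abel
        rw [hexp]
        refine (norm_add_le _ _).trans ?_
        rw [norm_one, norm_smul, Complex.norm_real, Real.norm_of_nonneg (sq_nonneg t), sq ‖a‖]
        gcongr
        exact norm_mul_le _ _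
      have hre : (1 - t * (f a).im) = (f ((1 : A) + (t * Complex.I : ℂ) • a)).re := by
        simp [h1]; ring
      calc (1 - t * (f a).im) ^ 2 ≤ ‖f ((1 : A) + (t * Complex.I : ℂ) • a)‖ ^ 2 := by
            rw [hre, sq_le_sq, abs_norm]; exact Complex.abs_re_le_norm _
        _ ≤ ‖(1 : A) + (t * Complex.I : ℂ) • a‖ ^ 2 := by gcongr; exact hf _
        _ ≤ _ := hn
    by_contra hne
    set β := (f a).im
    set M := ‖a‖ ^ 2
    have hM : 0 ≤ M := sq_nonneg _
    have hβ : 0 < β ^ 2 := by positivity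
    -- For this `t` the linear term `-2tβ = 2t²(M + 1)` exceeds `t²M`.
    have h2 := key (-β / (M + 1))
    have h3 : -β / (M + 1) * (M + 1) = -β := div_mul_cancel₀ _ (by positivity)
    set t := -β / (M + 1)
    have : -β = t * (M + 1) := h3.symm
    have ht : t ≠ 0 := by
      rintro h0
      rw [h0] at this
      have : β = 0 := by linarith
      exact hne this
    have ht2 : 0 < t ^ 2 := by positivity
    have hb : β = -(t * (M + 1)) := by linarith
    rw [hb] at h2
    nlinarith [mul_nonneg ht2.le hM, mul_nonneg (mul_nonneg ht2.le ht2.le) (sq_nonneg (M + 1))]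
  have hre : 0 ≤ (f a).re := by
    rcases eq_or_ne a 0 with rfl | ha0
    · simp
    have hpos : 0 < ‖a‖ := norm_pos_iff.2 ha0
    have hle : ‖algebraMap ℝ A ‖a‖ - a‖ ≤ ‖a‖ := by
      refine (CStarAlgebra.norm_le_iff_le_algebraMap _ hpos.le
        (sub_nonneg.2 hsa.le_algebraMap_norm_self)).2 ?_
      exact sub_le_self _ ha
    have h2 := (Complex.re_le_norm _).trans ((hf _).trans hle)
    have h3 : f (algebraMap ℝ A ‖a‖) = (‖a‖ : ℂ) := by
      rw [Algebra.algebraMap_eq_smul_one, ← Complex.coe_smul, map_smul, h1]; simp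
    rw [map_sub, h3] at h2
    simp at h2
    exact h2
  exact Complex.nonneg_iff.2 ⟨hre, him.symm⟩

/-- The normalized contractive linear functionals on `A` that vanish on `N`, as functions. -/
def contractiveStates (N : Ideal A) : Set (A → ℂ) :=
  {f | (∃ g : A →ₗ[ℂ] ℂ, ⇑g = f) ∧ f 1 = 1 ∧ (∀ a, ‖f a‖ ≤ ‖a‖) ∧ ∀ n ∈ N, f n = 0}

/-- Banach-Alaoglu in product form: a pointwise closed subset of a product of closed discs. -/
theorem isCompact_contractiveStates (N : Ideal A) : IsCompact (contractiveStates N) := by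
  refine (isCompact_univ_pi fun a : A => isCompact_closedBall (0 : ℂ) ‖a‖).of_isClosed_subset ?_ ?_
  · have h : contractiveStates N = Set.range ((↑) : (A →ₗ[ℂ] ℂ) → A → ℂ) ∩ ({f | f 1 = 1} ∩
        ((⋂ a, {f | ‖f a‖ ≤ ‖a‖}) ∩ ⋂ n ∈ N, {f | f n = 0})) := by
      ext f; simp [contractiveStates]
    rw [h]
    refine (LinearMap.isClosed_range_coe A ℂ (RingHom.id ℂ)).inter
      ((isClosed_eq (continuous_apply _) continuous_const).inter (IsClosed.inter ?_ ?_))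
    · exact isClosed_iInter fun a => isClosed_le (continuous_apply a).norm continuous_const
    · exact isClosed_biInter fun n _ => isClosed_eq (continuous_apply n) continuous_const
  · intro f hf a _
    simpa using hf.2.2.1 a

/-- Every proper left ideal of a unital C⋆-algebra annihilates a nonzero vector of some irreducible
representation. -/
theorem exists_irreducible_of_one_notMem (N : Ideal A) (hN : (1 : A) ∉ N) :
    ∃ (H : Type u) (_ : NormedAddCommGroup H) (_ : InnerProductSpace ℂ H) (_ : CompleteSpace H)
      (π : A →⋆ₐ[ℂ] (H →L[ℂ] H)) (ξ : H), ξ ≠ 0 ∧ (∀ n ∈ N, π n ξ = 0) ∧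
        ∀ W : Submodule ℂ H, IsClosed (W : Set H) → (∀ a, ∀ x ∈ W, π a x ∈ W) →
          W = ⊥ ∨ W = ⊤ := by
  let _ := CStarAlgebra.spectralOrder A
  let _ := CStarAlgebra.spectralOrderedRing A
  have hne : (contractiveStates N).Nonempty := by
    obtain ⟨g, hg⟩ := exists_contractive_functional_of_one_notMem N hN
    exact ⟨g, ⟨g, rfl⟩, hg⟩
  -- Krein-Milman, applied only to the states vanishing on `N`. Irreducibility of the GNS
  -- representation will follow from extremality within this smaller set.
  obtain ⟨_, hext⟩ := (isCompact_contractiveStates N).extremePoints_nonempty hne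
  rw [mem_extremePoints] at hext
  obtain ⟨⟨⟨g, rfl⟩, hg1, hgb, hgN⟩, hext⟩ := hext
  let f : A →ₚ[ℂ] ℂ := .mk₀ g fun a ha => nonneg_apply_of_contractive g hg1 hgb ha
  let ξ : f.GNS := (f.toPreGNS 1 : f.PreGNS)
  have hξ : ∀ a, f.gnsStarAlgHom a ξ = (f.toPreGNS a : f.PreGNS) := fun a => by
    simp [ξ]
  have hinner : ∀ a b, ⟪f.gnsStarAlgHom a ξ, f.gnsStarAlgHom b ξ⟫_ℂ = g (star a * b) := by
    intro a b
    rw [hξ, hξ, UniformSpace.Completion.inner_coe, f.preGNS_inner_def]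
    rfl
  have hξ1 : f.gnsStarAlgHom 1 ξ = ξ := by simp
  have hg : ∀ a, ⟪ξ, f.gnsStarAlgHom a ξ⟫_ℂ = g a := fun a => by
    simpa [hξ1] using hinner 1 a
  have hξξ : ⟪ξ, ξ⟫_ℂ = 1 := by rw [← hg1, ← hg 1, hξ1]
  have hdense : ∀ W : Submodule ℂ f.GNS, IsClosed (W : Set f.GNS) →
      (∀ a, f.gnsStarAlgHom a ξ ∈ W) → W = ⊤ := by
    intro W hW h
    refine Submodule.eq_top_iff'.2 fun x => ?_
    induction x using UniformSpace.Completion.induction_on with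
    | hp => exact hW
    | ih x => rw [← f.toPreGNS_ofPreGNS x, ← hξ]; exact h _
  have hkill : ∀ n ∈ N, f.gnsStarAlgHom n ξ = 0 := by
    intro n hn
    rw [← inner_self_eq_zero (𝕜 := ℂ), hinner]
    exact hgN _ (N.mul_mem_left _ hn)
  have hadj : ∀ a (x y : f.GNS), ⟪f.gnsStarAlgHom a x, y⟫_ℂ = ⟪x, f.gnsStarAlgHom (star a) y⟫_ℂ := by
    intro a x y
    rw [map_star, ContinuousLinearMap.star_eq_adjoint, ContinuousLinearMap.adjoint_inner_right]
  refine ⟨f.GNS, inferInstance, inferInstance, inferInstance, f.gnsStarAlgHom, ξ, ?_, hkill, ?_⟩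
  · intro h0
    simp [h0] at hξξ
  intro W hW hinv
  have hinv' : ∀ a, ∀ x ∈ Wᗮ, f.gnsStarAlgHom a x ∈ Wᗮ := by
    intro a x hx
    rw [Submodule.mem_orthogonal] at hx ⊢
    intro w hw
    rw [← star_star a, ← hadj]
    exact hx _ (hinv _ _ hw)
  have _ : CompleteSpace W := hW.completeSpace_coe
  obtain ⟨η, hη, ζ, hζ, hsum⟩ := Submodule.exists_add_mem_mem_orthogonal (K := W) ξ
  have hηζ : ⟪η, ζ⟫_ℂ = 0 := (Submodule.mem_orthogonal _ _).1 hζ _ hη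
  have hcross : ∀ a, ⟪η, f.gnsStarAlgHom a ζ⟫_ℂ = 0 := fun a =>
    (Submodule.mem_orthogonal _ _).1 (hinv' a _ hζ) _ hη
  have hcross' : ∀ a, ⟪ζ, f.gnsStarAlgHom a η⟫_ℂ = 0 := fun a =>
    (Submodule.mem_orthogonal' _ _).1 hζ _ (hinv a _ hη)
  by_cases hη0 : η = 0
  · left
    rw [← Submodule.orthogonal_eq_top_iff]
    rw [hη0, zero_add] at hsum
    exact hdense _ W.isClosed_orthogonal fun a => hinv' a _ (hsum ▸ hζ)
  by_cases hζ0 : ζ = 0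
  · right
    rw [hζ0, add_zero] at hsum
    exact hdense _ hW fun a => hinv a _ (hsum ▸ hη)
  exfalso
  have hpyth : ‖η‖ ^ 2 + ‖ζ‖ ^ 2 = 1 := by
    have h := norm_add_sq_eq_norm_sq_add_norm_sq_of_inner_eq_zero η ζ hηζ
    have h' : ‖ξ‖ ^ 2 = 1 := by
      have := inner_self_eq_norm_sq_to_K (𝕜 := ℂ) ξ
      rw [hξξ] at this
      exact Complex.ofReal_injective
        ((Complex.ofReal_pow _ _).trans (this.symm.trans Complex.ofReal_one.symm))
    rw [← hsum, ← sq, ← sq, ← sq, h'] at h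
    exact h.symm
  -- Both components of `ξ` must give states vanishing on `N`, or extremality would not apply. Their
  -- images under `n` are orthogonal with sum zero, so each vanishes.
  have hkillη : ∀ n ∈ N, f.gnsStarAlgHom n η = 0 := by
    intro n hn
    have h := hkill n hn
    rw [hsum, map_add] at h
    rw [← inner_self_eq_zero (𝕜 := ℂ)]
    have h2 : ⟪f.gnsStarAlgHom n η, f.gnsStarAlgHom n η + f.gnsStarAlgHom n ζ⟫_ℂ = 0 := by
      rw [h, inner_zero_right]
    rwa [inner_add_right, (Submodule.mem_orthogonal _ _).1 (hinv' n _ hζ) _ (hinv n _ hη),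
      add_zero] at h2
  have hkillζ : ∀ n ∈ N, f.gnsStarAlgHom n ζ = 0 := by
    intro n hn
    have h := hkill n hn
    rwa [hsum, map_add, hkillη n hn, zero_add] at h
  have hstate : ∀ v : f.GNS, v ≠ 0 → (∀ n ∈ N, f.gnsStarAlgHom n v = 0) →
      (fun a => ((‖v‖ ^ 2)⁻¹ : ℂ) * ⟪v, f.gnsStarAlgHom a v⟫_ℂ) ∈ contractiveStates N := by
    intro v hv hvN
    have hv' : 0 < ‖v‖ := norm_pos_iff.2 hv
    have hvC : (‖v‖ : ℂ) ≠ 0 := by exact_mod_cast hv'.ne'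
    refine ⟨⟨{ toFun := fun a => ((‖v‖ ^ 2)⁻¹ : ℂ) * ⟪v, f.gnsStarAlgHom a v⟫_ℂ
               map_add' := fun a b => by
                 rw [map_add, add_apply, inner_add_right, mul_add]
               map_smul' := fun c a => by
                 rw [map_smul, smul_apply, inner_smul_right, RingHom.id_apply,
                   smul_eq_mul, mul_left_comm] }, rfl⟩, ?_, ?_, ?_⟩
    · beta_reduce
      rw [map_one, one_apply_eq_self, inner_self_eq_norm_sq_to_K]
      exact inv_mul_cancel₀ (pow_ne_zero _ hvC)
    · intro a
      rw [norm_mul, norm_inv, norm_pow, Complex.norm_real, norm_norm, inv_mul_le_iff₀ (by positivity)]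
      calc ‖⟪v, f.gnsStarAlgHom a v⟫_ℂ‖ ≤ ‖v‖ * (‖f.gnsStarAlgHom a‖ * ‖v‖) :=
            (norm_inner_le_norm _ _).trans (by gcongr; exact ContinuousLinearMap.le_opNorm _ _)
        _ ≤ ‖v‖ * (‖a‖ * ‖v‖) := by
            gcongr; exact NonUnitalStarAlgHom.norm_apply_le f.gnsStarAlgHom a
        _ = ‖v‖ ^ 2 * ‖a‖ := by ring
    · intro n hn
      simp only [hvN n hn, inner_zero_right, mul_zero]
  have hη' : 0 < ‖η‖ ^ 2 := by have := norm_pos_iff.2 hη0; positivity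
  have hζ' : 0 < ‖ζ‖ ^ 2 := by have := norm_pos_iff.2 hζ0; positivity
  have hηC : (‖η‖ ^ 2 : ℂ) ≠ 0 := by exact_mod_cast hη'.ne'
  have hζC : (‖ζ‖ ^ 2 : ℂ) ≠ 0 := by exact_mod_cast hζ'.ne'
  have heq := (hext _ (hstate η hη0 hkillη) _ (hstate ζ hζ0 hkillζ)
    ⟨‖η‖ ^ 2, ‖ζ‖ ^ 2, hη', hζ', hpyth, by
      ext a
      simp only [Pi.add_apply, Pi.smul_apply, Complex.real_smul, Complex.ofReal_pow]
      rw [mul_inv_cancel_left₀ hηC, mul_inv_cancel_left₀ hζC, ← hg, hsum, map_add, inner_add_left,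
        inner_add_right, inner_add_right, hcross, hcross', add_zero, zero_add]⟩).1
  -- Extremality makes the vector state of `η` equal to `g`, so `η - ‖η‖² ξ` is orthogonal to the
  -- cyclic space. Then `η = ‖η‖² ξ`, and pairing with `ζ` gives a contradiction.
  have hperp : ∀ a, ⟪η - (‖η‖ ^ 2 : ℂ) • ξ, f.gnsStarAlgHom a ξ⟫_ℂ = 0 := by
    intro a
    have h := congrFun heq a
    rw [inv_mul_eq_iff_eq_mul₀ hηC] at h
    have h2 : ⟪η, f.gnsStarAlgHom a ξ⟫_ℂ = ⟪η, f.gnsStarAlgHom a η⟫_ℂ := by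
      rw [hsum, map_add, inner_add_right, hcross, add_zero]
    rw [inner_sub_left, inner_smul_left, hg, h2, h]
    simp
  have htop := hdense (ℂ ∙ (η - (‖η‖ ^ 2 : ℂ) • ξ))ᗮ (Submodule.isClosed_orthogonal _) fun a =>
    Submodule.mem_orthogonal_singleton_iff_inner_right.2 (hperp a)
  rw [Submodule.orthogonal_eq_top_iff, Submodule.span_singleton_eq_bot, sub_eq_zero] at htop
  have h3 : ⟪ζ, η⟫_ℂ = 0 := by rw [← inner_conj_symm, hηζ, map_zero]
  have h4 := h3
  rw [htop, inner_smul_right, hsum, inner_add_right, h3, zero_add] at h4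
  rcases mul_eq_zero.1 h4 with h | h
  · exact hηC h
  · exact hζ0 (inner_self_eq_zero.1 h)

end Unital

/-! ### Primitive ideals that avoid a sequence of elements -/

section NonUnital

variable {B : Type v} [NonUnitalCStarAlgebra B]

/-- The left ideal of the unitization of `B` whose elements multiply the tail of the sequence `b`
into the ideal `K` of `B`. -/
def tailIdeal (K : ClosedIdeal B) (b : ℕ → B) : Ideal (Unitization ℂ B) where
  carrier := {x | ∀ᶠ m in Filter.atTop, ∃ k ∈ K, x * (b m : Unitization ℂ B) = k}
  zero_mem' := Filter.Eventually.of_forall fun _ => ⟨0, K.zero_mem', by simp⟩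
  add_mem' hx hy := by
    filter_upwards [hx, hy] with m ⟨k, hk, hxk⟩ ⟨l, hl, hyl⟩
    exact ⟨k + l, K.add_mem' hk hl, by rw [add_mul, hxk, hyl, Unitization.inr_add]⟩
  smul_mem' c x hx := by
    filter_upwards [hx] with m ⟨k, hk, hxk⟩
    refine ⟨c.fst • k + c.snd * k, K.add_mem' (K.smul_mem' _ hk) (K.mul_left_mem _ hk), ?_⟩
    rw [smul_eq_mul, mul_assoc, hxk, Unitization.inr_add, Unitization.inr_smul,
      Unitization.inr_mul]
    conv_lhs => rw [← Unitization.inl_fst_add_inr_snd_eq c]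
    rw [add_mul, Unitization.inl_mul_inr, Unitization.inr_smul]

/-- The tail left ideal contains `K` and every `1 - b n`, because earlier terms act as units on
later ones; it is proper because no `b m` lies in `K`. A vector annihilated along it is killed by
`K` and fixed by all `b n`. -/
theorem ClosedIdeal.exists_isPrimitive_of_seq (K : ClosedIdeal B) (b : ℕ → B)
    (hb : ∀ n, b n * b (n + 1) = b (n + 1)) (hbK : ∀ n, b n ∉ K) :
    ∃ P : ClosedIdeal B, P.IsPrimitive ∧ K ≤ P ∧ ∀ n, b n ∉ P := by
  have hmul : ∀ n m, n < m → b n * b m = b m := by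
    intro n m hnm
    induction m, hnm using Nat.le_induction with
    | base => exact hb n
    | succ m _ ih => rw [← hb m, ← mul_assoc, ih]
  have h1 : (1 : Unitization ℂ B) ∉ tailIdeal K b := by
    intro h
    obtain ⟨m, k, hk, hm⟩ := Filter.Eventually.exists (f := Filter.atTop) h
    rw [one_mul] at hm
    exact hbK m (Unitization.inr_injective hm ▸ hk)
  have hK : ∀ k ∈ K, (k : Unitization ℂ B) ∈ tailIdeal K b := fun k hk =>
    Filter.Eventually.of_forall fun m =>
      ⟨k * b m, K.mul_right_mem _ hk, (Unitization.inr_mul ℂ k (b m)).symm⟩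
  have hsub : ∀ n, 1 - (b n : Unitization ℂ B) ∈ tailIdeal K b := by
    intro n
    filter_upwards [Filter.eventually_gt_atTop n] with m hm
    refine ⟨0, K.zero_mem', ?_⟩
    rw [sub_mul, one_mul, ← Unitization.inr_mul, hmul n m hm, sub_self, Unitization.inr_zero]
  obtain ⟨H, _, _, _, π, ξ, hξ, hN, hirr⟩ := exists_irreducible_of_one_notMem _ h1
  have hbξ : ∀ n, π (b n) ξ = ξ := by
    intro n
    have h := hN _ (hsub n)
    rw [map_sub, map_one, sub_apply, one_apply_eq_self, sub_eq_zero] at h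
    exact h.symm
  let ρ : B →⋆ₙₐ[ℂ] (H →L[ℂ] H) :=
    (π : Unitization ℂ B →⋆ₙₐ[ℂ] (H →L[ℂ] H)).comp (Unitization.inrNonUnitalStarAlgHom ℂ B)
  have hρ : ∀ a, ρ a = π (a : Unitization ℂ B) := fun _ => rfl
  let P : ClosedIdeal B :=
    { carrier := {a | ρ a = 0}
      zero_mem' := map_zero ρ
      add_mem' := fun {x y} hx hy => by
        change ρ (x + y) = 0
        rw [map_add, show ρ x = 0 from hx, show ρ y = 0 from hy, add_zero]
      smul_mem' := fun c x hx => by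
        change ρ (c • x) = 0
        rw [map_smul, show ρ x = 0 from hx, smul_zero]
      mul_left_mem := fun a x hx => by
        change ρ (a * x) = 0
        rw [map_mul, show ρ x = 0 from hx, mul_zero]
      mul_right_mem := fun a x hx => by
        change ρ (x * a) = 0
        rw [map_mul, show ρ x = 0 from hx, zero_mul]
      closed := by
        have hc : Continuous ρ := AddMonoidHomClass.continuous_of_bound ρ 1 fun a => by
          simpa using NonUnitalStarAlgHom.norm_apply_le ρ a
        exact isClosed_eq hc continuous_const }
  have hmemP : ∀ a, a ∈ P ↔ ρ a = 0 := fun _ => Iff.rfl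
  have hbP : ∀ n, b n ∉ P := by
    intro n h
    rw [hmemP, hρ] at h
    have := hbξ n
    rw [h, zero_apply] at this
    exact hξ this.symm
  refine ⟨P, ⟨H, _, _, _, ρ, ⟨⟨b 0, fun h => hbP 0 ((hmemP _).2 h)⟩, ?_⟩, hmemP⟩, ?_, hbP⟩
  · intro W hW hinv
    refine hirr W hW fun a x hx => ?_
    rw [← Unitization.inl_fst_add_inr_snd_eq a, map_add, add_apply]
    refine W.add_mem ?_ (hinv _ x hx)
    have : (Unitization.inl a.fst : Unitization ℂ B) = algebraMap ℂ _ a.fst := rfl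
    rw [this, AlgHomClass.commutes, Algebra.algebraMap_eq_smul_one, smul_apply,
      one_apply_eq_self]
    exact W.smul_mem _ hx
  -- The vectors killed by `K` form a closed invariant subspace containing `ξ ≠ 0`, hence all of
  -- `H`.
  · let W : Submodule ℂ H := ⨅ k : K, LinearMap.ker (ρ k : H →ₗ[ℂ] H)
    have hmem : ∀ x, x ∈ W ↔ ∀ k ∈ K, ρ k x = 0 := fun x => by simp [W]
    have hWc : IsClosed (W : Set H) := by
      have : (W : Set H) = ⋂ k ∈ K, {x | ρ k x = 0} := by ext; simp [hmem]
      rw [this]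
      exact isClosed_biInter fun k _ => isClosed_eq (ρ k).continuous continuous_const
    have hWinv : ∀ a, ∀ x ∈ W, π a x ∈ W := by
      intro a x hx
      rw [hmem] at hx ⊢
      intro k hk
      have hka : (k : Unitization ℂ B) * a = ((a.fst • k + k * a.snd : B) : Unitization ℂ B) := by
        conv_lhs => rw [← Unitization.inl_fst_add_inr_snd_eq a]
        rw [mul_add, Unitization.inr_mul_inl, Unitization.inr_add, Unitization.inr_mul]
      have h := hx _ (K.add_mem' (K.smul_mem' a.fst hk) (K.mul_right_mem a.snd hk))
      rwa [hρ, ← hka, map_mul] at h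
    have hξW : ξ ∈ W := (hmem ξ).2 fun k hk => hN _ (hK k hk)
    rcases hirr W hWc hWinv with h | h
    · rw [h] at hξW
      exact absurd ((Submodule.mem_bot ℂ).1 hξW) hξ
    · intro k hk
      refine (hmemP k).2 ?_
      ext x
      exact (hmem x).1 (h ▸ Submodule.mem_top) k hk

/-! ### Functional calculus and closed ideals -/

/-- Here `c * v` truncates `c` to the spectrum outside `[-ε, ε]`, where the function `t²/max(t²,
ε²)` defining `c * u` is 1. The factored forms put both elements in every ideal containing `c`. -/
theorem exists_approximate_units_of_isSelfAdjoint {c : B} (hc : IsSelfAdjoint c) {ε : ℝ}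
    (hε : 0 < ε) : ∃ u v : B, (c * u) * (c * v) = c * v ∧ IsSelfAdjoint (c * u) ∧ ‖c * u‖ ≤ 1 ∧
      ‖c - (c * u) * c‖ ≤ ε ∧ IsSelfAdjoint (c * v) ∧ ‖c - c * v‖ ≤ ε := by
  let k : ℝ → ℝ := fun t => t / max (t ^ 2) (ε ^ 2)
  let m : ℝ → ℝ := fun t => max (|t| - ε) 0 / max |t| ε
  have hk : Continuous k := Continuous.div₀ (by fun_prop) (by fun_prop) fun t =>
    (lt_max_of_lt_right (by positivity)).ne'
  have hm : Continuous m := Continuous.div₀ (by fun_prop) (by fun_prop) fun t =>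
    (lt_max_of_lt_right hε).ne'
  have hk0 : k 0 = 0 := by simp [k]
  have hm0 : m 0 = 0 := by simp [m, hε.le]
  have hcase : ∀ t : ℝ, (t * k t = 1 ∧ ε ≤ |t|) ∨
      (t * m t = 0 ∧ 0 ≤ t * k t ∧ t * k t ≤ 1 ∧ |t| ≤ ε) := by
    intro t
    rcases le_total ε |t| with h | h
    · left
      have h2 : ε ^ 2 ≤ t ^ 2 := by rw [← sq_abs t]; gcongr
      have ht : t ≠ 0 := by rintro rfl; simp at h; linarith
      refine ⟨?_, h⟩
      simp only [k, max_eq_left h2]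
      field_simp
    · right
      refine ⟨by simp [m, h], ?_, ?_, h⟩
      · simp only [k]; rw [← mul_div_assoc, ← sq]; positivity
      · simp only [k]; rw [← mul_div_assoc, ← sq]
        exact div_le_one_of_le₀ (le_max_left _ _) (by positivity)
  have hdist : ∀ t : ℝ, |t - t * m t| ≤ ε := by
    intro t
    rcases le_total ε |t| with h | h
    · have ht : 0 < |t| := hε.trans_le h
      have : t - t * m t = t * (ε / |t|) := by
        simp only [m]
        rw [max_eq_left h, max_eq_left (sub_nonneg.2 h)]
        field_simp
        ring
      rw [this, abs_mul, abs_div, abs_abs, abs_of_pos hε, mul_div_cancel₀ _ ht.ne']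
    · simp [m, h]
  clear_value k m
  have hu : c * cfcₙ k c = cfcₙ (fun t => t * k t) c := by
    rw [cfcₙ_mul (fun t => t) k c, cfcₙ_id' ℝ c]
  have hv : c * cfcₙ m c = cfcₙ (fun t => t * m t) c := by
    rw [cfcₙ_mul (fun t => t) m c, cfcₙ_id' ℝ c]
  have hk' : Continuous fun t => t * k t := by fun_prop
  have hm' : Continuous fun t => t * m t := by fun_prop
  refine ⟨cfcₙ k c, cfcₙ m c, ?_, ?_, ?_, ?_, ?_, ?_⟩
  · rw [hu, hv, ← cfcₙ_mul (fun t => t * k t) (fun t => t * m t) c]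
    congr 1
    ext t
    rcases hcase t with h | h
    · rw [h.1, one_mul]
    · rw [h.1, mul_zero]
  · rw [hu]; exact IsSelfAdjoint.cfcₙ
  · rw [hu]
    refine norm_cfcₙ_le fun t _ => ?_
    rw [Real.norm_eq_abs, abs_le]
    rcases hcase t with h | h
    · rw [h.1]; norm_num
    · exact ⟨by linarith [h.2.1], h.2.2.1⟩
  · have : c - c * cfcₙ k c * c = cfcₙ (fun t => t - t * k t * t) c := by
      rw [cfcₙ_sub (fun t => t) (fun t => t * k t * t) c,
        cfcₙ_mul (fun t => t * k t) (fun t => t) c, cfcₙ_id' ℝ c, hu]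
    rw [this]
    refine norm_cfcₙ_le fun t _ => ?_
    rcases hcase t with h | h
    · rw [h.1]; simp [hε.le]
    · have : t - t * k t * t = (1 - t * k t) * t := by ring
      rw [this, norm_mul, Real.norm_eq_abs, Real.norm_eq_abs,
        abs_of_nonneg (by linarith [h.2.2.1])]
      nlinarith [h.2.1, h.2.2.1, h.2.2.2, abs_nonneg t]
  · rw [hv]; exact IsSelfAdjoint.cfcₙ
  · have : c - c * cfcₙ m c = cfcₙ (fun t => t - t * m t) c := by
      rw [cfcₙ_sub (fun t => t) (fun t => t * m t) c, cfcₙ_id' ℝ c, hv]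
    rw [this]
    exact norm_cfcₙ_le fun t _ => hdist t

/-! ### Relative density and the Baire property of the primitive ideal space -/

namespace ClosedIdeal

theorem mem_of_forall_dist_le (K : ClosedIdeal B) {y : B}
    (h : ∀ ε > 0, ∃ k ∈ K, ‖y - k‖ ≤ ε) : y ∈ K := by
  have : y ∈ closure (K : Set B) := by
    rw [Metric.mem_closure_iff]
    intro ε hε
    obtain ⟨k, hk, hle⟩ := h (ε / 2) (half_pos hε)
    exact ⟨k, hk, by rw [dist_eq_norm]; linarith⟩
  rwa [IsClosed.closure_eq (s := (K : Set B)) K.closed] at this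

theorem mem_of_star_mul_self_mem (K : ClosedIdeal B) {y : B} (h : star y * y ∈ K) : y ∈ K := by
  refine K.mem_of_forall_dist_le fun ε hε => ?_
  -- The tolerance `ε² / 2` is chosen because `‖y - y * w‖²` splits into two terms of at most that
  -- size.
  obtain ⟨u, -, -, hw, hw1, hle, -⟩ := exists_approximate_units_of_isSelfAdjoint
    (IsSelfAdjoint.star_mul_self y) (show 0 < ε ^ 2 / 2 by positivity)
  set a := star y * y with ha
  set w := a * u
  refine ⟨y * w, K.mul_left_mem _ (K.mul_right_mem _ h), ?_⟩
  rw [← sq_le_sq₀ (norm_nonneg _) hε.le, sq, ← CStarRing.norm_star_mul_self]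
  have hexp : star (y - y * w) * (y - y * w) = (a - w * a) - (a - w * a) * w := by
    rw [star_sub, star_mul, hw.star_eq, ha]
    noncomm_ring
  rw [hexp]
  calc ‖(a - w * a) - (a - w * a) * w‖ ≤ ε ^ 2 / 2 + ε ^ 2 / 2 * 1 := by
        refine (norm_sub_le _ _).trans (add_le_add hle ((norm_mul_le _ _).trans ?_))
        gcongr
    _ = ε ^ 2 := by ring

theorem star_mem (K : ClosedIdeal B) {y : B} (h : y ∈ K) : star y ∈ K :=
  K.mem_of_star_mul_self_mem (by rw [star_star]; exact K.mul_right_mem _ h)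

/-- Otherwise `x * h ∈ K` for all `x ∈ M`, so `h` lies in the ideal of those `y ∈ L` with `M y ⊆ K`.
This ideal meets `M` inside `K`, and density puts it inside `K`. -/
theorem exists_star_mul_self_conj_notMem {K L M : ClosedIdeal B}
    (hLM : ∀ J ≤ L, M ⊓ J ≤ K → J ≤ K) {h : B} (hh : IsSelfAdjoint h) (hL : h ∈ L) (hK : h ∉ K) :
    ∃ x ∈ M, h * (star x * x) * h ∉ K := by
  by_contra! hcon
  let J : ClosedIdeal B :=
    { carrier := {y | y ∈ L ∧ ∀ x ∈ M, x * y ∈ K}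
      zero_mem' := ⟨L.zero_mem', fun x _ => by rw [mul_zero]; exact K.zero_mem'⟩
      add_mem' := fun hy hz => ⟨L.add_mem' hy.1 hz.1, fun x hx => by
        rw [mul_add]; exact K.add_mem' (hy.2 x hx) (hz.2 x hx)⟩
      smul_mem' := fun c y hy => ⟨L.smul_mem' c hy.1, fun x hx => by
        rw [mul_smul_comm]; exact K.smul_mem' c (hy.2 x hx)⟩
      mul_left_mem := fun a y hy => ⟨L.mul_left_mem a hy.1, fun x hx => by
        rw [← mul_assoc]; exact hy.2 _ (M.mul_right_mem a hx)⟩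
      mul_right_mem := fun a y hy => ⟨L.mul_right_mem a hy.1, fun x hx => by
        rw [← mul_assoc]; exact K.mul_right_mem a (hy.2 x hx)⟩
      closed := by
        have : {y | y ∈ L ∧ ∀ x ∈ M, x * y ∈ K} =
            (L : Set B) ∩ ⋂ x ∈ M, (fun y => x * y) ⁻¹' (K : Set B) := by ext; simp
        rw [this]
        exact L.closed.inter (isClosed_biInter fun x _ => K.closed.preimage (by fun_prop)) }
  refine hK (hLM J (fun y hy => hy.1) (fun y hy => ?_) (show h ∈ J from ⟨hL, fun x hx => ?_⟩))
  · exact K.mem_of_star_mul_self_mem (hy.2.2 _ (M.star_mem hy.1))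
  · refine K.mem_of_star_mul_self_mem ?_
    have := hcon x hx
    rwa [star_mul, hh.star_eq, mul_assoc, ← mul_assoc (star x), ← mul_assoc]

/-- A Baire category property of the primitive ideal space: if each `L (n + 1)` is dense in
`L n` relative to the hull of `K`, and `L 0` meets this hull, then some primitive ideal in the hull
of `K` contains none of the ideals `L n`. -/
theorem exists_isPrimitive_of_dense (K : ClosedIdeal B) (L : ℕ → ClosedIdeal B) (h0 : ¬ L 0 ≤ K)
    (hL : ∀ n, ∀ J ≤ L n, L (n + 1) ⊓ J ≤ K → J ≤ K) :
    ∃ P : ClosedIdeal B, P.IsPrimitive ∧ K ≤ P ∧ ∀ n, ¬ L n ≤ P := by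
  have step : ∀ n (c : {c : B // IsSelfAdjoint c ∧ c ∈ L n ∧ c ∉ K}),
      ∃ (u : B) (d : {c : B // IsSelfAdjoint c ∧ c ∈ L (n + 1) ∧ c ∉ K}),
        c.1 * u * d.1 = d.1 ∧ c.1 * u ∉ K := by
    rintro n ⟨c, hc, hcL, hcK⟩
    -- With `ε` below the distance from `c` to `K`, the truncation `c * v` stays outside `K`.
    -- Conjugating some `star x * x` from `L (n + 1)` by it gives the next element, on which `c * u`
    -- acts as a unit.
    obtain ⟨ε, hε, hεK⟩ : ∃ ε > 0, ∀ k ∈ K, ε < ‖c - k‖ := by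
      by_contra! hcon
      exact hcK (K.mem_of_forall_dist_le hcon)
    obtain ⟨u, v, huv, -, -, -, hv, hcv⟩ := exists_approximate_units_of_isSelfAdjoint hc hε
    have hvK : c * v ∉ K := fun h => absurd hcv (not_le.2 (hεK _ h))
    obtain ⟨x, hx, hxK⟩ := exists_star_mul_self_conj_notMem (hL n) hv
      ((L n).mul_right_mem v hcL) hvK
    refine ⟨u, ⟨c * v * (star x * x) * (c * v), ?_, ?_, hxK⟩, ?_, ?_⟩
    · rw [IsSelfAdjoint, star_mul, star_mul (c * v), star_mul (star x), hv.star_eq, star_star,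
        ← mul_assoc]
    · exact (L (n + 1)).mul_right_mem _ ((L (n + 1)).mul_left_mem _
        ((L (n + 1)).mul_left_mem _ hx))
    · change c * u * (c * v * (star x * x) * (c * v)) = _
      rw [← mul_assoc (c * u), ← mul_assoc (c * u), huv]
    · intro h
      exact hvK (huv ▸ K.mul_right_mem _ h)
  choose u next hnext huK using step
  obtain ⟨x, hx, hxK⟩ : ∃ x ∈ L 0, x ∉ K := by
    by_contra! hcon
    exact h0 hcon
  let c : ∀ n, {c : B // IsSelfAdjoint c ∧ c ∈ L n ∧ c ∉ K} := fun n =>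
    Nat.rec ⟨star x * x, .star_mul_self x, (L 0).mul_left_mem _ hx,
      fun h => hxK (K.mem_of_star_mul_self_mem h)⟩ next n
  obtain ⟨P, hP, hKP, hbP⟩ := K.exists_isPrimitive_of_seq (fun n => (c n).1 * u n (c n))
    (fun n => by rw [← mul_assoc]; exact congrArg (· * _) (hnext n (c n))) fun n => huK n (c n)
  exact ⟨P, hP, hKP, fun n hn => hbP n (P.mul_right_mem _ (hn (c n).2.2.1))⟩

/-- Every closed ideal is the intersection of the primitive ideals that contain it. -/
theorem le_of_forall_isPrimitive {J K : ClosedIdeal B}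
    (h : ∀ P : ClosedIdeal B, P.IsPrimitive → K ≤ P → J ≤ P) : J ≤ K := by
  by_contra hJK
  -- For the constant sequence, density is automatic.
  obtain ⟨P, hP, hKP, hJP⟩ := K.exists_isPrimitive_of_dense (fun _ => J) hJK fun _ I hI hIJ =>
    (le_inf hI le_rfl).trans hIJ
  exact hJP 0 (h P hP hKP)

end ClosedIdeal

end NonUnital

/-! ### Topologies on spaces of prime and primitive ideals -/

section Topology

theorem PrimeSpace.isOpen_iff {L : Type u} [CompleteLattice L] {U : Set (PrimeSpace L)} :
    IsOpen U ↔ ∃ I : L, U = {p | ¬ I ≤ p.1} := Iff.rfl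

/-- The `I n` define a shrinking neighbourhood base at `p`. If `q ≰ p`, the open set of `q` is a
neighbourhood of `p` missing `q`, so some `I n` is below `q`. -/
theorem PrimeSpace.exists_seq_of_firstCountable {L : Type u} [CompleteLattice L]
    [FirstCountableTopology (PrimeSpace L)] (p : PrimeSpace L) :
    ∃ I : ℕ → L, (∀ n, ¬ I n ≤ p.1) ∧
      ∀ q : PrimeSpace L, p.1 ≤ q.1 → (∀ n, ¬ I n ≤ q.1) → q = p := by
  obtain ⟨s, hs⟩ := (nhds p).exists_antitone_basis
  have hI : ∀ n, ∃ I : L, ¬ I ≤ p.1 ∧ {q : PrimeSpace L | ¬ I ≤ q.1} ⊆ s n := by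
    intro n
    obtain ⟨U, hU, ⟨I, rfl⟩, hp⟩ := mem_nhds_iff.1 (hs.mem n)
    exact ⟨I, hp, hU⟩
  choose I hIp hIs using hI
  refine ⟨I, hIp, fun q hpq hq => ?_⟩
  by_contra hne
  have hnle : ¬ q.1 ≤ p.1 := fun h => hne (Subtype.ext (le_antisymm h hpq))
  have hopen : IsOpen {r : PrimeSpace L | ¬ q.1 ≤ r.1} := ⟨q.1, rfl⟩
  obtain ⟨n, hn⟩ := hs.mem_iff.1 (hopen.mem_nhds hnle)
  exact hn (hIs n (hq n)) le_rfl

variable {A : Type u} [NonUnitalCStarAlgebra A]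

theorem PrimitiveSpace.isOpen_iff {U : Set (PrimitiveSpace A)} :
    IsOpen U ↔ ∃ I : ClosedIdeal A, U = {p | ¬ I ≤ p.1} := by
  rw [isOpen_induced_iff]
  constructor
  · rintro ⟨_, ⟨I, rfl⟩, rfl⟩
    exact ⟨I, rfl⟩
  · rintro ⟨I, rfl⟩
    exact ⟨_, ⟨I, rfl⟩, rfl⟩

end Topology

/-! ### The Galois connection between induction and restriction -/

section Galois

variable {A : Type u} {B : Type v} [NonUnitalCStarAlgebra A] [NonUnitalCStarAlgebra B]
  {φ : A →⋆ₙₐ[ℂ] 𝓜(ℂ, B)}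

theorem induceIdeal_le_iff {I : ClosedIdeal A} {J : ClosedIdeal B} :
    induceIdeal φ I ≤ J ↔ I ≤ restrictIdeal φ J := by
  constructor
  · intro h x hx
    have key : ∀ b₁ b₂ : B, b₁ * (φ x).fst b₂ ∈ J := fun b₁ b₂ =>
      h ((inducedSpan φ I).le_topologicalClosure (Submodule.subset_span ⟨x, hx, b₁, b₂, rfl⟩))
    refine fun b => ⟨J.mem_of_forall_mul_mem fun c => key c b,
      J.mem_of_forall_mem_mul fun c => ?_⟩
    rw [(φ x).central]
    exact key b c
  · intro h
    have hspan : inducedSpan φ I ≤ J.toSubmodule := by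
      refine Submodule.span_le.2 ?_
      rintro _ ⟨x, hx, b₁, b₂, rfl⟩
      exact J.mul_left_mem _ (h hx b₂).1
    exact (inducedSpan φ I).topologicalClosure_minimal hspan J.closed

theorem galoisConnection_induceIdeal_restrictIdeal :
    GaloisConnection (induceIdeal φ) (restrictIdeal φ) := fun _ _ => induceIdeal_le_iff

theorem RestrictedIdeal.restrictIdeal_induceIdeal (I : RestrictedIdeal φ) :
    restrictIdeal φ (induceIdeal φ I.1) = I.1 := by
  obtain ⟨_, J, rfl⟩ := I
  exact galoisConnection_induceIdeal_restrictIdeal.u_l_u_eq_u J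

theorem RestrictedIdeal.induceIdeal_le_induceIdeal_iff {I : ClosedIdeal A} {J : RestrictedIdeal φ} :
    induceIdeal φ I ≤ induceIdeal φ J.1 ↔ I ≤ J.1 := by
  rw [induceIdeal_le_iff, J.restrictIdeal_induceIdeal]

/-- Hence `r ∘ i` plays for ideals of `A` the role that `F` plays for ideals of `B`. -/
theorem RestrictedIdeal.restrictTo_induceIdeal_le_iff {J : ClosedIdeal A} {I : RestrictedIdeal φ} :
    restrictTo φ (induceIdeal φ J) ≤ I ↔ J ≤ I.1 := by
  refine ⟨(galoisConnection_induceIdeal_restrictIdeal.le_u_l J).trans, fun h => ?_⟩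
  change restrictIdeal φ (induceIdeal φ J) ≤ I.1
  rw [← I.restrictIdeal_induceIdeal]
  exact galoisConnection_induceIdeal_restrictIdeal.monotone_u
    (galoisConnection_induceIdeal_restrictIdeal.monotone_l h)

theorem IsInduced.induceIdeal_restrictIdeal {J : ClosedIdeal B} (h : IsInduced φ J) :
    induceIdeal φ (restrictIdeal φ J) = J := by
  obtain ⟨I, rfl⟩ := h
  exact galoisConnection_induceIdeal_restrictIdeal.l_u_l_eq_l I

theorem RestrictedIdeal.eq_top_of_val_eq_top {I : RestrictedIdeal φ} (h : I.1 = ⊤) : I = ⊤ :=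
  top_le_iff.1 (show (⊤ : RestrictedIdeal φ).1 ≤ I.1 from h ▸ le_top)

theorem le_inducedHull (J : ClosedIdeal B) : J ≤ inducedHull φ J := le_sInf fun _ hK => hK.2

theorem inducedHull_le {J K : ClosedIdeal B} (hK : IsInduced φ K) (h : J ≤ K) :
    inducedHull φ J ≤ K := sInf_le ⟨hK, h⟩

theorem CondMI.isInduced_inducedHull (h : CondMI φ) (J : ClosedIdeal B) :
    IsInduced φ (inducedHull φ J) := h _ fun _ hK => hK.1

theorem CondMI.condMIf (h : CondMI φ) : CondMIf φ := fun S _ hS => h S hS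

/-- This is the empty meet; it keeps restrictions of proper ideals proper. -/
theorem CondMIf.induceIdeal_top (h : CondMIf φ) : induceIdeal φ ⊤ = ⊤ := by
  obtain ⟨I, hI⟩ := h ∅ Set.finite_empty (by simp)
  rw [sInf_empty] at hI
  rw [eq_top_iff, hI]
  exact galoisConnection_induceIdeal_restrictIdeal.monotone_l le_top

/-- An induced meet is recovered from its restriction, and `r` preserves meets. This is what makes
restrictions of primes prime. -/
theorem CondMIf.induceIdeal_inf (h : CondMIf φ) (I J : RestrictedIdeal φ) :
    induceIdeal φ (I.1 ⊓ J.1) = induceIdeal φ I.1 ⊓ induceIdeal φ J.1 := by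
  have hK : IsInduced φ (induceIdeal φ I.1 ⊓ induceIdeal φ J.1) := by
    rw [← sInf_pair]
    refine h _ (Set.toFinite _) ?_
    rintro K (rfl | rfl)
    exacts [⟨_, rfl⟩, ⟨_, rfl⟩]
  rw [← hK.induceIdeal_restrictIdeal, galoisConnection_induceIdeal_restrictIdeal.u_inf,
    I.restrictIdeal_induceIdeal, J.restrictIdeal_induceIdeal]

theorem CondMIf.infPrime_restrictTo (h : CondMIf φ) {P : ClosedIdeal B} (hP : InfPrime P) :
    InfPrime (restrictTo φ P) := by
  refine ⟨fun hmax => hP.1 ?_, fun I J hIJ => ?_⟩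
  · rw [isMax_iff_eq_top] at hmax ⊢
    have htop : (⊤ : ClosedIdeal A) ≤ restrictIdeal φ P := by
      have hA : IsRestricted φ (⊤ : ClosedIdeal A) := by
        rw [← sInf_empty]; exact IsRestricted.sInf (by simp)
      have : (⟨⊤, hA⟩ : RestrictedIdeal φ) ≤ restrictTo φ P := by
        rw [hmax]; exact le_top (α := RestrictedIdeal φ)
      exact this
    rwa [← induceIdeal_le_iff, h.induceIdeal_top, top_le_iff] at htop
  · have hle : induceIdeal φ (I.1 ⊓ J.1) ≤ P := induceIdeal_le_iff.2 hIJ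
    rw [h.induceIdeal_inf] at hle
    exact (hP.2 hle).imp (fun h => induceIdeal_le_iff.1 h) fun h => induceIdeal_le_iff.1 h

theorem CondMIf.restrictsPrimitives (h : CondMIf φ) : RestrictsPrimitives φ := fun P =>
  h.infPrime_restrictTo P.2.infPrime

theorem continuous_primitiveRestriction (hr : RestrictsPrimitives φ) :
    Continuous (primitiveRestriction φ hr) := by
  refine continuous_def.2 ?_
  rintro _ ⟨I, rfl⟩
  refine PrimitiveSpace.isOpen_iff.2 ⟨induceIdeal φ I.1, ?_⟩
  ext P
  exact not_congr induceIdeal_le_iff.symm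

/-! ### Consequences of openness of the restriction map -/

/-- Induced ideals cannot distinguish points `e x` with the same restriction, while `i(G J) ≰ e x`
says that `J ≰ e y` for some `y` in the fibre of `x`. So `i(G J)` is the least induced ideal above
`J`. The abstract family `e` covers prime and primitive ideals at once. -/
theorem condMI_and_condC2_of_open {X : Type*} (e : X → ClosedIdeal B)
    (he : ∀ x, InfPrime (e x)) (hr : ∀ x, InfPrime (restrictTo φ (e x)))
    (hsep : ∀ J K, (∀ x, K ≤ e x → J ≤ e x) → J ≤ K)
    (hopen : ∀ J : ClosedIdeal B, ∃ G : RestrictedIdeal φ, ∀ p : RestrictedPrimeSpace φ,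
      ¬ G ≤ p.1 ↔ ∃ x, ¬ J ≤ e x ∧ restrictTo φ (e x) = p.1) :
    CondMI φ ∧ (∀ J, IsLeast {K | IsInduced φ K ∧ J ≤ K} (inducedHull φ J)) ∧ CondC2 φ := by
  choose G hG using hopen
  have hGx : ∀ J x, ¬ induceIdeal φ (G J).1 ≤ e x ↔
      ∃ y, ¬ J ≤ e y ∧ restrictTo φ (e y) = restrictTo φ (e x) := fun J x =>
    (not_congr induceIdeal_le_iff).trans (hG J ⟨_, hr x⟩)
  have hle_iff : ∀ {K} (_ : IsInduced φ K) {x y}, restrictTo φ (e y) = restrictTo φ (e x) →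
      (K ≤ e x ↔ K ≤ e y) := by
    intro K hK x y hxy
    rw [← hK.induceIdeal_restrictIdeal, induceIdeal_le_iff, induceIdeal_le_iff,
      show restrictIdeal φ (e y) = restrictIdeal φ (e x) from congrArg Subtype.val hxy]
  have hleast : ∀ J, IsLeast {K | IsInduced φ K ∧ J ≤ K} (induceIdeal φ (G J).1) := by
    refine fun J => ⟨⟨⟨_, rfl⟩, hsep _ _ fun x hx => ?_⟩, fun K hK => hsep _ _ fun x hx => ?_⟩
    · by_contra hJ
      exact (hGx J x).2 ⟨x, hJ, rfl⟩ hx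
    · by_contra hJ
      obtain ⟨y, hy, hxy⟩ := (hGx J x).1 hJ
      exact hy (hK.2.trans ((hle_iff hK.1 hxy).1 hx))
  have hhull : ∀ J, inducedHull φ J = induceIdeal φ (G J).1 := fun J => (hleast J).isGLB.sInf_eq
  refine ⟨fun S hS => ⟨(G (sInf S)).1, le_antisymm (hleast _).1.2 ?_⟩, fun J => hhull J ▸ hleast J,
    fun I J hI => le_antisymm (hsep _ _ fun x hx => ?_) (le_inf ?_ ?_)⟩
  · exact le_sInf fun K hK => (hleast _).2 ⟨hS K hK, sInf_le hK⟩
  -- Move to a point `y` of the fibre with `J ≰ e y`. The induced ideal `I` is still not below `e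
  -- y`, so primeness excludes `I ⊓ J ≤ e y`.
  · by_contra hIJ
    have hIx : ¬ I ≤ e x := fun h => hIJ (inf_le_left.trans h)
    have hJx : ¬ inducedHull φ J ≤ e x := fun h => hIJ (inf_le_right.trans h)
    rw [hhull, hGx] at hJx
    obtain ⟨y, hy, hxy⟩ := hJx
    rw [hhull] at hx
    refine (hGx (I ⊓ J) x).2 ⟨y, fun h => ?_, hxy⟩ hx
    exact ((he y).2 h).elim (fun h => hIx ((hle_iff hI hxy).2 h)) hy
  · exact inducedHull_le hI inf_le_left
  · rw [hhull J]
    exact inducedHull_le (hleast J).1.1 (inf_le_right.trans (hleast J).1.2)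

theorem condMI_and_condC2_of_isOpenMap_primeRestriction (hr : RestrictsPrimes φ)
    (h : IsOpenMap (primeRestriction φ hr)) :
    CondMI φ ∧ (∀ J, IsLeast {K | IsInduced φ K ∧ J ≤ K} (inducedHull φ J)) ∧ CondC2 φ := by
  refine condMI_and_condC2_of_open (X := PrimeSpace (ClosedIdeal B)) (fun P => P.1)
    (fun P => P.2) hr (fun J K hJK => ClosedIdeal.le_of_forall_isPrimitive fun P hP =>
      hJK ⟨P, hP.infPrime⟩) fun J => ?_
  obtain ⟨G, hG⟩ := PrimeSpace.isOpen_iff.1 (h {P | ¬ J ≤ P.1} ⟨J, rfl⟩)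
  refine ⟨G, fun p => ?_⟩
  rw [show ¬ G ≤ p.1 ↔ p ∈ {p : RestrictedPrimeSpace φ | ¬ G ≤ p.1} from Iff.rfl, ← hG]
  exact exists_congr fun P => and_congr Iff.rfl Subtype.ext_iff

theorem condMI_and_condC2_of_isOpenMap_primitiveRestriction (hr : RestrictsPrimitives φ)
    (h : IsOpenMap (primitiveRestriction φ hr)) : CondMI φ ∧ CondC2 φ := by
  refine (condMI_and_condC2_of_open (X := PrimitiveSpace B) (fun P => P.1)
    (fun P => P.2.infPrime) hr (fun J K hJK => ClosedIdeal.le_of_forall_isPrimitive fun P hP =>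
      hJK ⟨P, hP⟩) fun J => ?_).imp id And.right
  obtain ⟨G, hG⟩ := PrimeSpace.isOpen_iff.1
    (h {P | ¬ J ≤ P.1} (PrimitiveSpace.isOpen_iff.2 ⟨J, rfl⟩))
  refine ⟨G, fun p => ?_⟩
  rw [show ¬ G ≤ p.1 ↔ p ∈ {p : RestrictedPrimeSpace φ | ¬ G ≤ p.1} from Iff.rfl, ← hG]
  exact exists_congr fun P => and_congr Iff.rfl Subtype.ext_iff

/-! ### Openness and surjectivity of the restriction map -/

theorem exists_primitiveRestriction_eq (hMI : CondMI φ) (hC2 : CondC2 φ)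
    [FirstCountableTopology (RestrictedPrimeSpace φ)] (hr : RestrictsPrimitives φ)
    (p : RestrictedPrimeSpace φ) {J : ClosedIdeal B} (hJ : ¬ J ≤ induceIdeal φ p.1.1) :
    ∃ P : PrimitiveSpace B, ¬ J ≤ P.1 ∧ primitiveRestriction φ hr P = p := by
  obtain ⟨I, hIp, hI⟩ := PrimeSpace.exists_seq_of_firstCountable p
  obtain ⟨P, hP, hpP, hLP⟩ := (induceIdeal φ p.1.1).exists_isPrimitive_of_dense
    -- Placing `J` first makes `P` avoid it; the ideals `i(I n)` are shifted by one. For density,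
    -- (C2) replaces `J'` by its hull, primeness of `p` cancels `I n`, and (MI) recovers the hull
    -- from its restriction.
    (fun n => Nat.casesOn n J fun n => induceIdeal φ (I n).1) hJ fun n J' _ hle => by
      have h1 : induceIdeal φ (I n).1 ⊓ inducedHull φ J' ≤ induceIdeal φ p.1.1 := by
        rw [hC2 _ _ ⟨_, rfl⟩]
        exact inducedHull_le ⟨_, rfl⟩ hle
      have h2 := galoisConnection_induceIdeal_restrictIdeal (φ := φ) |>.monotone_u h1
      rw [galoisConnection_induceIdeal_restrictIdeal.u_inf, (I n).restrictIdeal_induceIdeal,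
        p.1.restrictIdeal_induceIdeal] at h2
      have h3 : restrictTo φ (inducedHull φ J') ≤ p.1 :=
        (p.2.2 (show I n ⊓ restrictTo φ (inducedHull φ J') ≤ p.1 from h2)).resolve_left (hIp n)
      refine (le_inducedHull (φ := φ) J').trans ?_
      rw [← (hMI.isInduced_inducedHull J').induceIdeal_restrictIdeal]
      exact galoisConnection_induceIdeal_restrictIdeal.monotone_l h3
  refine ⟨⟨P, hP⟩, hLP 0, hI _ (induceIdeal_le_iff.1 hpP) fun n hn => hLP (n + 1) ?_⟩
  exact induceIdeal_le_iff.2 hn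

theorem isOpenMap_primitiveRestriction (hMI : CondMI φ) (hC2 : CondC2 φ)
    [FirstCountableTopology (RestrictedPrimeSpace φ)] (hr : RestrictsPrimitives φ) :
    IsOpenMap (primitiveRestriction φ hr) := by
  intro U hU
  obtain ⟨J, rfl⟩ := PrimitiveSpace.isOpen_iff.1 hU
  refine PrimeSpace.isOpen_iff.2 ⟨restrictTo φ (inducedHull φ J), ?_⟩
  ext p
  constructor
  · rintro ⟨P, hP, rfl⟩ hle
    have h : induceIdeal φ (restrictIdeal φ (inducedHull φ J)) ≤ P.1 := induceIdeal_le_iff.2 hle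
    rw [(hMI.isInduced_inducedHull J).induceIdeal_restrictIdeal] at h
    exact hP ((le_inducedHull J).trans h)
  · intro hp
    refine exists_primitiveRestriction_eq hMI hC2 hr p fun hJ => hp ?_
    have h := galoisConnection_induceIdeal_restrictIdeal (φ := φ) |>.monotone_u
      (inducedHull_le ⟨_, rfl⟩ hJ)
    rwa [p.1.restrictIdeal_induceIdeal] at h

theorem surjective_primitiveRestriction (hMI : CondMI φ) (hC2 : CondC2 φ)
    [FirstCountableTopology (RestrictedPrimeSpace φ)] (hr : RestrictsPrimitives φ) :
    Function.Surjective (primitiveRestriction φ hr) := by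
  intro p
  have htop : ¬ ⊤ ≤ induceIdeal φ p.1.1 := fun h => p.2.1 (isMax_iff_eq_top.2 (by
    rw [← hMI.condMIf.induceIdeal_top, RestrictedIdeal.induceIdeal_le_induceIdeal_iff,
      top_le_iff] at h
    exact RestrictedIdeal.eq_top_of_val_eq_top h))
  obtain ⟨P, -, hP⟩ := exists_primitiveRestriction_eq hMI hC2 hr p htop
  exact ⟨P, hP⟩

/-! ### First countability -/

theorem secondCountableTopology_restrictedPrimeSpace [SecondCountableTopology (PrimitiveSpace A)] :
    SecondCountableTopology (RestrictedPrimeSpace φ) := by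
  have hbasis := TopologicalSpace.isBasis_countableBasis (PrimitiveSpace A)
  have hI : ∀ U ∈ TopologicalSpace.countableBasis (PrimitiveSpace A),
      ∃ I : ClosedIdeal A, U = {p | ¬ I ≤ p.1} := fun U hU =>
    PrimitiveSpace.isOpen_iff.1 (hbasis.isOpen hU)
  have _ : Nonempty (ClosedIdeal A) := ⟨⊤⟩
  choose! I hI using hI
  refine (TopologicalSpace.isTopologicalBasis_of_isOpen_of_nhds
    (s := (fun U => {p : RestrictedPrimeSpace φ | ¬ restrictTo φ (induceIdeal φ (I U)) ≤ p.1}) ''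
      TopologicalSpace.countableBasis (PrimitiveSpace A)) ?_ ?_).secondCountableTopology
    ((TopologicalSpace.countable_countableBasis _).image _)
  · rintro _ ⟨U, -, rfl⟩
    exact ⟨_, rfl⟩
  · rintro p _ hp ⟨J, rfl⟩
    -- The prime `p` need not come from a primitive ideal, so a primitive `Q` above it selects the
    -- basic open set. Inclusion of open sets then gives inclusion of ideals.
    obtain ⟨Q, hQ, hpQ, hJQ⟩ : ∃ Q : ClosedIdeal A, Q.IsPrimitive ∧ p.1.1 ≤ Q ∧ ¬ J.1 ≤ Q := by
      by_contra! hcon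
      exact hp (ClosedIdeal.le_of_forall_isPrimitive hcon)
    obtain ⟨U, hU, hQU, hUJ⟩ := hbasis.exists_subset_of_mem_open
      (show (⟨Q, hQ⟩ : PrimitiveSpace A) ∈ {P : PrimitiveSpace A | ¬ J.1 ≤ P.1} from hJQ)
      (PrimitiveSpace.isOpen_iff.2 ⟨J.1, rfl⟩)
    rw [hI U hU] at hQU hUJ
    have hIJ : I U ≤ J.1 := ClosedIdeal.le_of_forall_isPrimitive fun P hP hJP => by
      by_contra h
      have hmem : (⟨P, hP⟩ : PrimitiveSpace A) ∈ {P : PrimitiveSpace A | ¬ I U ≤ P.1} := h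
      exact hUJ hmem hJP
    exact ⟨_, ⟨U, hU, rfl⟩, fun h => hQU
      ((RestrictedIdeal.restrictTo_induceIdeal_le_iff.1 h).trans hpQ), fun q hq hJq => hq
      ((RestrictedIdeal.restrictTo_induceIdeal_le_iff.2 hIJ).trans hJq)⟩

/-! ### The quasi-orbit space -/

theorem exists_quasiOrbitProj_eq (hJR : CondJR φ) (hC1 : CondC1 φ)
    [FirstCountableTopology (RestrictedPrimeSpace φ)] (p : RestrictedPrimeSpace φ)
    {J : ClosedIdeal A} (hJ : ¬ J ≤ p.1.1) :
    ∃ P : PrimitiveSpace A, ¬ J ≤ P.1 ∧ quasiOrbitProj φ hJR P = p := by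
  obtain ⟨I, hIp, hI⟩ := PrimeSpace.exists_seq_of_firstCountable p
  obtain ⟨P, hP, hpP, hLP⟩ := p.1.1.exists_isPrimitive_of_dense
    (fun n => Nat.casesOn n J fun n => (I n).1) hJ fun n J' _ h => by
      change (I n).1 ⊓ J' ≤ _ at h
      -- Passing to restricted hulls lets (C1) split the meet, so that primeness of `p` among
      -- restricted ideals applies.
      rw [← RestrictedIdeal.restrictTo_induceIdeal_le_iff (φ := φ)] at h ⊢
      have h2 : I n ⊓ restrictTo φ (induceIdeal φ J') ≤ p.1 :=
        (hC1 (I n).1 J' (I n).2).le.trans h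
      exact (p.2.2 h2).resolve_left (hIp n)
  refine ⟨⟨P, hP⟩, hLP 0, hI _ ((le_largestRestricted_iff hJR P p.1).2 hpP) fun n hn =>
    hLP (n + 1) ((le_largestRestricted_iff hJR P (I n)).1 hn)⟩

theorem continuous_quasiOrbitProj (hJR : CondJR φ) : Continuous (quasiOrbitProj φ hJR) := by
  refine continuous_def.2 ?_
  rintro _ ⟨I, rfl⟩
  refine PrimitiveSpace.isOpen_iff.2 ⟨I.1, ?_⟩
  ext P
  exact not_congr (le_largestRestricted_iff hJR P.1 I)

theorem isOpenMap_quasiOrbitProj (hJR : CondJR φ) (hC1 : CondC1 φ)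
    [FirstCountableTopology (RestrictedPrimeSpace φ)] : IsOpenMap (quasiOrbitProj φ hJR) := by
  intro U hU
  obtain ⟨J, rfl⟩ := PrimitiveSpace.isOpen_iff.1 hU
  refine PrimeSpace.isOpen_iff.2 ⟨restrictTo φ (induceIdeal φ J), ?_⟩
  ext p
  constructor
  · rintro ⟨P, hP, rfl⟩ hle
    exact hP ((RestrictedIdeal.restrictTo_induceIdeal_le_iff.1 hle).trans
      ((le_largestRestricted_iff hJR P.1 (quasiOrbitProj φ hJR P).1).1 le_rfl))
  · intro hp
    exact exists_quasiOrbitProj_eq hJR hC1 p fun hJ =>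
      hp (RestrictedIdeal.restrictTo_induceIdeal_le_iff.2 hJ)

theorem surjective_quasiOrbitProj (hJR : CondJR φ) (hC1 : CondC1 φ)
    [FirstCountableTopology (RestrictedPrimeSpace φ)] :
    Function.Surjective (quasiOrbitProj φ hJR) := by
  intro p
  obtain ⟨P, -, hP⟩ := exists_quasiOrbitProj_eq hJR hC1 p (J := ⊤) fun h =>
    p.2.1 (isMax_iff_eq_top.2 (RestrictedIdeal.eq_top_of_val_eq_top (top_le_iff.1 h)))
  exact ⟨P, hP⟩

theorem isHomeomorph_quasiOrbitEmbedding (hJR : CondJR φ) (hC1 : CondC1 φ)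
    [FirstCountableTopology (RestrictedPrimeSpace φ)] :
    IsHomeomorph (quasiOrbitEmbedding φ hJR) := by
  refine ⟨(continuous_quasiOrbitProj hJR).quotient_lift _, fun U hU => ?_, ?_, fun p => ?_⟩
  · have : quasiOrbitEmbedding φ hJR '' U = quasiOrbitProj φ hJR '' (Quotient.mk _ ⁻¹' U) := by
      rw [← Set.image_preimage_eq U Quotient.mk_surjective, Set.preimage_image_preimage,
        ← Set.image_comp]
      rfl
    rw [this]
    exact isOpenMap_quasiOrbitProj hJR hC1 _ (hU.preimage continuous_quotient_mk')
  · rintro ⟨P⟩ ⟨Q⟩ h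
    exact Quotient.sound h
  · obtain ⟨P, hP⟩ := surjective_quasiOrbitProj hJR hC1 p
    exact ⟨Quotient.mk _ P, hP⟩

end Galois

theorem theorem4p8 {A : Type u} {B : Type v} [NonUnitalCStarAlgebra A] [NonUnitalCStarAlgebra B]
    (φ : A →⋆ₙₐ[ℂ] 𝓜(ℂ, B)) :
    -- consequences of `r` being an open surjection on prime ideals
    (∀ hr : RestrictsPrimes φ, Continuous (primeRestriction φ hr) →
      IsOpenMap (primeRestriction φ hr) → Function.Surjective (primeRestriction φ hr) →
      CondMI φ ∧ (∀ J, IsLeast {K | IsInduced φ K ∧ J ≤ K} (inducedHull φ J)) ∧ CondC2 φ) ∧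
    -- the converse
    (CondMI φ → CondC2 φ → FirstCountableTopology (RestrictedPrimeSpace φ) →
      ∃ hr : RestrictsPrimitives φ, Continuous (primitiveRestriction φ hr) ∧
        IsOpenMap (primitiveRestriction φ hr) ∧ Function.Surjective (primitiveRestriction φ hr)) ∧
    -- a sufficient condition for first countability
    (SecondCountableTopology (PrimitiveSpace A) →
      FirstCountableTopology (RestrictedPrimeSpace φ)) ∧
    -- the quasi-orbit map exists, and when it is open and surjective
    (∀ hJR : CondJR φ, CondC1 φ → CondMIf φ → FirstCountableTopology (RestrictedPrimeSpace φ) →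
      ∃ (hr : RestrictsPrimitives φ) (he : IsHomeomorph (quasiOrbitEmbedding φ hJR)),
        Continuous (quasiOrbitMap φ hJR hr he) ∧
        (IsOpenMap (quasiOrbitMap φ hJR hr he) ∧ Function.Surjective (quasiOrbitMap φ hJR hr he) ↔
          CondMI φ ∧ CondC2 φ)) := by
  refine ⟨fun hr _ ho _ => condMI_and_condC2_of_isOpenMap_primeRestriction hr ho,
    fun hMI hC2 _ => ⟨hMI.condMIf.restrictsPrimitives, continuous_primitiveRestriction _,
      isOpenMap_primitiveRestriction hMI hC2 _, surjective_primitiveRestriction hMI hC2 _⟩,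
    fun _ => ?_, fun hJR hC1 hMIf _ => ?_⟩
  · have := secondCountableTopology_restrictedPrimeSpace (φ := φ)
    infer_instance
  · have hr := hMIf.restrictsPrimitives
    have he := isHomeomorph_quasiOrbitEmbedding hJR hC1
    let Φ := he.homeomorph (quasiOrbitEmbedding φ hJR)
    have hq : quasiOrbitMap φ hJR hr he = Φ.symm ∘ primitiveRestriction φ hr := rfl
    refine ⟨hr, he, ?_, ?_⟩
    · rw [hq]
      exact Φ.symm.continuous.comp (continuous_primitiveRestriction hr)
    · rw [hq, Φ.symm.comp_isOpenMap_iff, EquivLike.comp_surjective]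
      exact ⟨fun h => condMI_and_condC2_of_isOpenMap_primitiveRestriction hr h.1, fun h =>
        ⟨isOpenMap_primitiveRestriction h.1 h.2 hr, surjective_primitiveRestriction h.1 h.2 hr⟩⟩
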